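/- Let $G=(V,E)$ be a finite undirected multigraph (loops, multiple edges and isolated vertices are allowed) with $k$ connected components, and let \[ \mathcal{C}_G=\mathrm{conv}\bigl(\mathbf e_i+\mathbf e_j-\mathbf e_f,\ \mathbf e_i-\mathbf e_j+\mathbf e_f,\ -\mathbf e_i+\mathbf e_j+\mathbf e_f \;:\; f=ij\in E\bigr)\subset\mathbb{R}^{V\cup E} \] be its cosmological polytope, where the $\mathbf e_\alpha$ ($\alpha\in V\cup E$) are the standard unit vectors and $i=j$ if $f$ is a loop. Let $h^\ast(\mathcal{C}_G;z)$ be its $h^\ast$-polynomial, i.e. the polynomial with \[ 1+\sum_{t\ge 1}\bigl|t\,\mathcal{C}_G\cap\mathbb{Z}^{V\cup E}\bigr|\,z^t=\frac{h^\ast(\mathcal{C}_G;z)}{(1-z)^{\dim \mathcal{C}_G+1}} \] (with $\dim\emptyset=-1$ if $E=\emptyset$). Then, coefficientwise, \[ (1+3z)^{|V|-k}(1+z)^{|E|-|V|+k}\;\preccurlyeq\; h^\ast(\mathcal{C}_G;z), \] that is, for every $i\ge 0$ the coefficient of $z^i$ on the left is at most the one on the right. Moreover, equality of the two polynomials holds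 if and only if $G$ is a $1$-sum of loops and a forest, i.e. $G$ can be obtained from a forest (possibly with isolated vertices) by taking successive $1$-sums with finitely many (possibly zero) graphs consisting of a single vertex with a single loop. Here a $1$-sum of two graphs is obtained from their disjoint union by identifying one vertex of the first with one vertex of the second. -/

import Mathlib

open scoped Graph

noncomputable section

namespace Cosmo

/-! ### Ehrhart theory -/

section Ehrhart

variable {ι : Type*}

/-- The lattice points of `t P`, i.e. the elements of `t P ∩ ℤ^ι`. -/
def latticePoints (P : Set (ι → ℝ)) (t : ℕ) : Set (ι → ℤ) :=
  {m | ∃ p ∈ P, ∀ a, (m a : ℝ) = (t : ℝ) * p a}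

open Classical in
/-- The number `dim P + 1`, where `dim P` is the dimension of the affine hull of `P`
and, as usual, `dim ∅ = -1`. -/
def dimSucc (P : Set (ι → ℝ)) : ℕ :=
  if P.Nonempty then Module.finrank ℝ (vectorSpan ℝ P) + 1 else 0

/-- The Ehrhart series `1 + ∑_{t > 0} |t P ∩ ℤ^ι| z^t` of a lattice polytope `P ⊆ ℝ^ι`. -/
def ehrhartSeries (P : Set (ι → ℝ)) : PowerSeries ℤ :=
  PowerSeries.mk fun t => if t = 0 then 1 else ((latticePoints P t).ncard : ℤ)

/-- `h` is the `h^*`-polynomial of `P`: the numerator in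
`Ehr(P; z) = h(z) / (1 - z) ^ (dim P + 1)`. There is at most one such `h`. -/
def IsHStarPolynomial (P : Set (ι → ℝ)) (h : Polynomial ℤ) : Prop :=
  (h : PowerSeries ℤ) = ehrhartSeries P * (1 - PowerSeries.X) ^ dimSucc P

end Ehrhart

/-! ### Multigraphs and cosmological polytopes -/

section Graphs

variable {α β : Type*}

open Classical in
/-- The standard unit vector `e_a` of `ℝ^(V ∪ E)`, for `a` a vertex or an edge of `G`. -/
def unitVec (G : Graph α β) (a : V(G) ⊕ E(G)) : V(G) ⊕ E(G) → ℝ :=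
  Pi.single a 1

/-- The cosmological polytope of `G`: the convex hull in `ℝ^(V ∪ E)` of the points
`e_i + e_j - e_f`, `e_i - e_j + e_f` and `-e_i + e_j + e_f`, for all edges `f = ij` of `G`
(with `i = j` if `f` is a loop). -/
def cosmologicalPolytope (G : Graph α β) : Set (V(G) ⊕ E(G) → ℝ) :=
  convexHull ℝ {p | ∃ (i j : V(G)) (f : E(G)), G.IsLink f i j ∧
    (p = unitVec G (.inl i) + unitVec G (.inl j) - unitVec G (.inr f) ∨
     p = unitVec G (.inl i) - unitVec G (.inl j) + unitVec G (.inr f) ∨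
     p = -unitVec G (.inl i) + unitVec G (.inl j) + unitVec G (.inr f))}

/-- The number of connected components of a multigraph. Loops and multiplicities of edges
are irrelevant for this, so the underlying simple graph is used. -/
def numComponents (G : Graph α β) : ℕ :=
  Nat.card G.toSimpleGraph.ConnectedComponent

/-- A forest: a multigraph without cycles, that is, without loops (cycles of length one),
without parallel edges (cycles of length two) and without longer cycles.
Isolated vertices are allowed. -/
def IsForest (G : Graph α β) : Prop :=
  G.Simple ∧ G.toSimpleGraph.IsAcyclic

/-- `G` is the `1`-sum of `G₁` and `G₂`, with `x` the vertex at which they are glued: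
`G` is the union of its subgraphs `G₁` and `G₂`, these have no edge in common, and `x` is
their only common vertex. Gluing disjoint graphs by identifying a vertex of one with a vertex
of the other produces, up to isomorphism, exactly this situation. -/
structure IsOneSum (G G₁ G₂ : Graph α β) (x : α) : Prop where
  left_le : G₁ ≤ G
  right_le : G₂ ≤ G
  vertexSet_union : V(G₁) ∪ V(G₂) = V(G)
  edgeSet_union : E(G₁) ∪ E(G₂) = E(G)
  vertexSet_inter : V(G₁) ∩ V(G₂) = {x}
  edgeSet_disjoint : Disjoint E(G₁) E(G₂)

/-- `G` is a `1`-sum of loops and a forest: it is obtained from a forest by successively taking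
`1`-sums with (finitely many, possibly zero) graphs consisting of one vertex and one loop. -/
inductive IsOneSumOfLoopsAndForest : Graph α β → Prop
  | forest {F : Graph α β} (hF : IsForest F) : IsOneSumOfLoopsAndForest F
  | addLoop {G H : Graph α β} {x : α} {e : β} (hH : IsOneSumOfLoopsAndForest H)
      (hG : IsOneSum G H (Graph.bouquet x {e}) x) : IsOneSumOfLoopsAndForest G

end Graphs

end Cosmo

end

/-!
Write `h(z) = ∑_F (2z)^|F| (1+z)^(|E|-|F|)`, the sum being over all forests `F ⊆ E`. The point is
that `h` is the `h^*`-polynomial of the cosmological polytope of `G`. Given this, the subsets of one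
spanning forest, which has `r = |V| - k` edges, contribute
`(2z + 1 + z)^r (1+z)^(|E|-r) = (1+3z)^r (1+z)^(|E|-r)`, and the other forests contribute
polynomials with nonnegative coefficients which are positive at `z = 1`. So equality holds if and
only if there are no other forests, i.e. if and only if the non-loops of `G` form a forest
(`forestSum_lower_bound`).

A lattice point `m` in the cone over the polytope is described by a flow condition: an edge `f = ij`
with `m_f ≥ 0` may transport `m_f` units between `i` and `j`, while one with `m_f < 0` consumes
`|m_f|` units at both `i` and `j`. By a max-flow min-cut argument this amounts to the nonnegativity
of one concave function for each vertex set `S` (`cutValue`). These functions are submodular in `S`,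
whence every lattice point of positive degree in the cone can be reduced by a lattice point of the
polytope (`exists_feasible_add`), and the Ehrhart series counts the points with nonnegative cut
functions by degree (`ehrhartSeries_convexHull_generators`).

The generating function `K_G` of these points obeys a deletion-contraction rule. Moving the
coordinate of `f` one step towards `0` shows that `(1-z) K_G` counts the points of `G - f` (once for
the coordinate `0` and once for the coordinate `-1` of `f`), and the points with positive coordinate
of `f` for which a cut separating `i` from `j` is tight. If `f` is a loop there are none of the latter.
Otherwise, after merging `i` and `j`, the lost coordinate of `i` can be recovered from the tight
cut, so that these points correspond to the points of the contraction `G / f`, once for either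
direction of the flow through `f` (`ncard_tightSet`). The sum over forests obeys the same rule
(`forestSum_insert`), which gives `feasibleSeries_mul_one_sub_pow`.

Forests are handled as independent sets of the vectors `e_i + e_j` over `ZMod 2`, which need no
orientation of the edges. For these, contraction is a quotient by a line
(`linearIndepOn_insert_iff_contract`), the rank is `|V| - k` (`finrank_span_incVec_add_card`), and
independence of the non-loops means the absence of cycles (`linearIndepOn_incVec_iff`).
-/

namespace Cosmo

/-! ### Cut functions -/

section Cut

variable {V E R : Type*} [CommRing R] [LinearOrder R]

open Classical in
/-- The contribution of an edge `e` with coordinate `x` to the cut function of a vertex set `S`: it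
is `x` if exactly one end of `e` is in `S`, and `min 0 (2 * x)` if both ends are in `S`. -/
noncomputable def cutWeight (S : Finset V) (e : Sym2 V) (x : R) : R :=
  if ∀ v ∈ e, v ∈ S then min 0 (2 * x) else if ∃ v ∈ e, v ∈ S then x else 0

/-- The cut function of a vertex set `S`, evaluated at the point with vertex coordinates `y` and
edge coordinates `x`. The cone over a cosmological polytope is cut out by the condition that all
these concave functions are nonnegative. -/
noncomputable def cutValue [Fintype E] (ends : E → Sym2 V) (S : Finset V) (y : V → R)
    (x : E → R) : R :=
  ∑ v ∈ S, y v + ∑ e, cutWeight S (ends e) (x e)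

lemma cutWeight_mk [DecidableEq V] (S : Finset V) (i j : V) (x : R) :
    cutWeight S s(i, j) x =
      if i ∈ S then (if j ∈ S then min 0 (2 * x) else x) else (if j ∈ S then x else 0) := by
  unfold cutWeight
  by_cases hi : i ∈ S <;> by_cases hj : j ∈ S <;> simp [hi, hj]

lemma cutWeight_zero (S : Finset V) (e : Sym2 V) : cutWeight S e (0 : R) = 0 := by
  simp [cutWeight]

lemma cutWeight_empty (e : Sym2 V) (x : R) : cutWeight ∅ e x = 0 := by
  classical
  induction e with | h a b => simp [cutWeight_mk]

lemma cutWeight_map [Fintype V] [DecidableEq V] (S : Finset V) (e : Sym2 V) (ρ : V → V) (x : R) :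
    cutWeight S (e.map ρ) x = cutWeight (Finset.univ.filter fun v => ρ v ∈ S) e x := by
  simp [cutWeight]

lemma cutWeight_inter_add_union [IsStrictOrderedRing R] [DecidableEq V] (S T : Finset V)
    (e : Sym2 V) (x : R) :
    cutWeight (S ∩ T) e x + cutWeight (S ∪ T) e x ≤ cutWeight S e x + cutWeight T e x := by
  induction e with | h a b =>
  simp only [cutWeight_mk, Finset.mem_inter, Finset.mem_union]
  have h0 : min 0 (2 * x) ≤ 0 := min_le_left _ _
  have h1 : min 0 (2 * x) ≤ 2 * x := min_le_right _ _
  by_cases ha : a ∈ S <;> by_cases hb : b ∈ S <;> by_cases ha' : a ∈ T <;> by_cases hb' : b ∈ T <;>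
    simp only [ha, hb, ha', hb', and_true, or_true, or_false, and_false, if_true,
      if_false] <;> linarith

section

variable [Fintype E] {ends : E → Sym2 V} {y : V → R} {x : E → R} {i j : V} {f : E}

lemma cutValue_add_left (S : Finset V) (z : V → R) :
    cutValue ends S (y + z) x = cutValue ends S y x + ∑ v ∈ S, z v := by
  simp only [cutValue, Pi.add_apply, Finset.sum_add_distrib]; ring

lemma cutValue_add_single [DecidableEq V] (S : Finset V) (i : V) (t : R) :
    cutValue ends S (y + Pi.single i t) x = cutValue ends S y x + if i ∈ S then t else 0 := by
  rw [cutValue_add_left, Finset.sum_pi_single']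

lemma cutValue_update [DecidableEq E] (S : Finset V) (f : E) (c : R) :
    cutValue ends S y (Function.update x f c) =
      cutValue ends S y x - cutWeight S (ends f) (x f) + cutWeight S (ends f) c := by
  have h : ∀ x : E → R, cutValue ends S y x = ∑ v ∈ S, y v +
      (∑ e ∈ Finset.univ.erase f, cutWeight S (ends e) (x e) + cutWeight S (ends f) (x f)) :=
    fun x => by rw [Finset.sum_erase_add _ _ (Finset.mem_univ f)]; rfl
  rw [h, h x, Function.update_self]
  have : ∑ e ∈ Finset.univ.erase f, cutWeight S (ends e) (Function.update x f c e) =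
      ∑ e ∈ Finset.univ.erase f, cutWeight S (ends e) (x e) :=
    Finset.sum_congr rfl fun e he => by rw [Function.update_of_ne (Finset.ne_of_mem_erase he)]
  rw [this]; ring

lemma cutValue_inter_add_union [IsStrictOrderedRing R] [DecidableEq V] (S T : Finset V) :
    cutValue ends (S ∩ T) y x + cutValue ends (S ∪ T) y x ≤
      cutValue ends S y x + cutValue ends T y x := by
  have h1 := Finset.sum_union_inter (s₁ := S) (s₂ := T) (f := y)
  have h2 := Finset.sum_le_sum fun e (_ : e ∈ Finset.univ) =>
    cutWeight_inter_add_union S T (ends e) (x e)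
  simp only [Finset.sum_add_distrib] at h2
  unfold cutValue
  linarith

/-- If `S` and `T` separate the ends `i`, `j` of an edge in opposite ways, then `S ∩ T` and `S ∪ T`
do not separate them, and submodularity holds with room to spare. -/
lemma cutValue_inter_add_union_add [IsStrictOrderedRing R] [DecidableEq V] [DecidableEq E]
    (hf : ends f = s(i, j)) (hx : 0 ≤ x f) {S T : Finset V} (hiS : i ∈ S) (hjS : j ∉ S)
    (hjT : j ∈ T) (hiT : i ∉ T) :
    cutValue ends (S ∩ T) y x + cutValue ends (S ∪ T) y x + 2 * x f ≤
      cutValue ends S y x + cutValue ends T y x := by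
  have h := cutValue_inter_add_union (ends := ends) (y := y) (x := Function.update x f 0) S T
  have h0 : min 0 (2 * x f) = 0 := min_eq_left (by linarith)
  simp only [cutValue_update, hf, cutWeight_mk, hiS, hjS, hjT, hiT, Finset.mem_inter,
    Finset.mem_union, true_or, or_true, and_false, false_and, if_true, if_false, h0,
    mul_zero, min_self, sub_zero, add_zero] at h
  linarith

/-- A cut function does not depend on the nonnegative coordinate of an edge whose ends are not
separated by the cut. -/
lemma cutValue_update_of_not_separated [IsStrictOrderedRing R] [DecidableEq E]
    (hf : ends f = s(i, j)) (hx : 0 ≤ x f) {c : R} (hc : 0 ≤ c) {S : Finset V}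
    (hS : i ∈ S ↔ j ∈ S) : cutValue ends S y (Function.update x f c) = cutValue ends S y x := by
  classical
  have h0 : min 0 (2 * x f) = 0 := min_eq_left (by linarith)
  have h1 : min 0 (2 * c) = 0 := min_eq_left (by linarith)
  rw [cutValue_update, hf, cutWeight_mk, cutWeight_mk]
  by_cases hj : j ∈ S <;> simp [hS, hj, h0, h1]

lemma cutValue_update_of_separated [DecidableEq E] (hf : ends f = s(i, j)) (c : R) {S : Finset V}
    (hS : ¬(i ∈ S ↔ j ∈ S)) :
    cutValue ends S y (Function.update x f c) = cutValue ends S y x + (c - x f) := by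
  classical
  rw [cutValue_update, hf, cutWeight_mk, cutWeight_mk]
  by_cases hi : i ∈ S <;> by_cases hj : j ∈ S <;> simp only [hi, hj, not_true, iff_true, iff_false,
    not_false_iff, iff_self] at hS <;> simp [hi, hj] <;> ring

/-- Trading a nonpositive coordinate of an edge for coordinates of its two ends. -/
lemma cutValue_update_of_nonpos [IsStrictOrderedRing R] [DecidableEq V] [DecidableEq E]
    (hf : ends f = s(i, j)) (hx : x f ≤ 0) {c : R} (hc : c ≤ 0) (S : Finset V) :
    cutValue ends S (y + Pi.single i (x f - c) + Pi.single j (x f - c)) (Function.update x f c) =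
      cutValue ends S y x := by
  have h0 : min 0 (2 * x f) = 2 * x f := min_eq_right (by linarith)
  have h1 : min 0 (2 * c) = 2 * c := min_eq_right (by linarith)
  rw [cutValue_add_single, cutValue_add_single, cutValue_update, hf, cutWeight_mk, cutWeight_mk]
  by_cases hi : i ∈ S <;> by_cases hj : j ∈ S <;> simp [hi, hj, h0, h1] <;> ring

end

end Cut

/-! ### Feasible points -/

section Feasible

variable {V E : Type*} [Fintype V] [Fintype E]

/-- The integer points of degree `n` in the cone over the cosmological polytope of the multigraph
with vertex set `W` and edge set `U`: all cut functions are nonnegative. -/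
def feasible (ends : E → Sym2 V) (W : Finset V) (U : Finset E) (n : ℤ) :
    Set ((V → ℤ) × (E → ℤ)) :=
  {m | (∀ v ∉ W, m.1 v = 0) ∧ (∀ e ∉ U, m.2 e = 0) ∧ (∀ S, 0 ≤ cutValue ends S m.1 m.2) ∧
    ∑ v, m.1 v + ∑ e, m.2 e = n}

variable {ends : E → Sym2 V} {W : Finset V} {U : Finset E} {n : ℤ} {m : (V → ℤ) × (E → ℤ)}

lemma sum_abs_le_of_mem_feasible (hm : m ∈ feasible ends W U n) : ∑ e, |m.2 e| ≤ n := by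
  obtain ⟨-, -, h, hn⟩ := hm
  have hS := h Finset.univ
  have hw : ∀ e, cutWeight Finset.univ (ends e) (m.2 e) = min 0 (2 * m.2 e) := fun e => by
    simp [cutWeight]
  simp only [cutValue, hw] at hS
  have : ∑ e, |m.2 e| + ∑ e, min 0 (2 * m.2 e) = ∑ e, m.2 e := by
    rw [← Finset.sum_add_distrib]
    refine Finset.sum_congr rfl fun e _ => ?_
    rcases abs_cases (m.2 e) with h | h <;> rcases min_cases 0 (2 * m.2 e) with h' | h' <;> omega
  omega

lemma abs_le_of_mem_feasible (hm : m ∈ feasible ends W U n) (e : E) : |m.2 e| ≤ n :=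
  (Finset.single_le_sum (f := fun e => |m.2 e|) (fun _ _ => abs_nonneg _)
    (Finset.mem_univ e)).trans (sum_abs_le_of_mem_feasible hm)

lemma neg_le_of_mem_feasible (hm : m ∈ feasible ends W U n) (v : V) : -n ≤ m.1 v := by
  have hS := hm.2.2.1 {v}
  have h : ∑ e, cutWeight {v} (ends e) (m.2 e) ≤ ∑ e, |m.2 e| :=
    Finset.sum_le_sum fun e _ => by
      unfold cutWeight
      split_ifs
      · exact (min_le_left _ _).trans (abs_nonneg _)
      · exact le_abs_self _
      · exact abs_nonneg _
  have h2 := sum_abs_le_of_mem_feasible hm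
  simp only [cutValue, Finset.sum_singleton] at hS
  omega

lemma finite_feasible : (feasible ends W U n).Finite := by
  classical
  refine Set.Finite.subset ((Set.finite_Icc (fun _ => -n) fun _ => n + Fintype.card V * n).prod
    (Set.finite_Icc (fun _ => -n) fun _ => n)) fun m hm => ?_
  have hx := abs_le_of_mem_feasible hm
  have hy := neg_le_of_mem_feasible hm
  refine ⟨⟨hy, fun v => ?_⟩, fun e => (abs_le.1 (hx e)).1, fun e => (abs_le.1 (hx e)).2⟩
  have h1 : -n * Fintype.card V ≤ ∑ w ∈ Finset.univ.erase v, m.1 w - n := by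
    have h := Finset.sum_le_sum fun w (_ : w ∈ Finset.univ.erase v) => hy w
    have hc := Finset.card_erase_add_one (Finset.mem_univ v)
    rw [Finset.sum_const, nsmul_eq_mul] at h
    rw [← Finset.card_univ, ← hc]
    push_cast
    linarith
  have h2 := Finset.sum_erase_add _ m.1 (Finset.mem_univ v)
  have h3 := hm.2.2.2
  have h4 : -∑ e, |m.2 e| ≤ ∑ e, m.2 e := by
    rw [← Finset.sum_neg_distrib]
    exact Finset.sum_le_sum fun e _ => neg_abs_le _
  have h5 := sum_abs_le_of_mem_feasible hm
  change m.1 v ≤ n + Fintype.card V * n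
  linarith

lemma feasible_insert_inter_eq_zero [DecidableEq E] {f : E} (hf : f ∉ U) :
    {m ∈ feasible ends W (insert f U) n | m.2 f = 0} = feasible ends W U n := by
  ext m
  constructor
  · rintro ⟨⟨h1, h2, h3⟩, h0⟩
    refine ⟨h1, fun e he => ?_, h3⟩
    by_cases hef : e = f
    · rw [hef, h0]
    · exact h2 e (by simp [hef, he])
  · rintro ⟨h1, h2, h3⟩
    exact ⟨⟨h1, fun e he => h2 e fun h => he (Finset.mem_insert_of_mem h), h3⟩, h2 f hf⟩

end Feasible

/-! ### Deletion and contraction -/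

lemma eq_of_update_eq {E : Type*} [DecidableEq E] {f : E} {x x' : E → ℤ} {c c' : ℤ}
    (h : x f = x' f) (hu : Function.update x f c = Function.update x' f c') : x = x' := by
  ext e
  by_cases he : e = f
  · rw [he, h]
  · simpa [he] using congrFun hu e

section Recursion

variable {V E : Type*} [Fintype V] [Fintype E]
  {ends : E → Sym2 V} {W : Finset V} {U : Finset E} {n : ℤ} {m : (V → ℤ) × (E → ℤ)}
  {i j : V} {f : E}

/-- The feasible points with a positive coordinate at the edge `f`, with ends `i` and `j`, for which
the cut function of some `S` with `i ∈ S` and `j ∉ S` vanishes. -/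
def tightSet (ends : E → Sym2 V) (W : Finset V) (U : Finset E) (n : ℤ) (f : E) (i j : V) :
    Set ((V → ℤ) × (E → ℤ)) :=
  {m ∈ feasible ends W U n | 1 ≤ m.2 f ∧ ∃ S : Finset V, i ∈ S ∧ j ∉ S ∧
    cutValue ends S m.1 m.2 = 0}

lemma tightSet_self : tightSet ends W U n f i i = ∅ := by
  ext m
  simp +contextual [tightSet]

variable [DecidableEq V] [DecidableEq E]

lemma sum_update_add (x : E → ℤ) (f : E) (c : ℤ) :
    ∑ e, Function.update x f c e + x f = ∑ e, x e + c := by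
  rw [Finset.sum_update_of_mem (Finset.mem_univ f), ← Finset.sum_sdiff (Finset.subset_univ {f})
    (f := x), Finset.sum_singleton]
  ring

/-- Replacing a nonpositive coordinate of an edge by another one, and compensating at the ends. -/
lemma update_mem_feasible_of_nonpos (hf : ends f = s(i, j)) (hfU : f ∈ U) (hi : i ∈ W) (hj : j ∈ W)
    (hm : m ∈ feasible ends W U n) (hx : m.2 f ≤ 0) {c : ℤ} (hc : c ≤ 0) :
    (m.1 + Pi.single i (m.2 f - c) + Pi.single j (m.2 f - c), Function.update m.2 f c) ∈
      feasible ends W U (n + m.2 f - c) := by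
  obtain ⟨h1, h2, h3, h4⟩ := hm
  refine ⟨fun v hv => ?_, fun e he => ?_, fun S => ?_, ?_⟩
  · have hvi : v ≠ i := fun h => hv (h ▸ hi)
    have hvj : v ≠ j := fun h => hv (h ▸ hj)
    simp [hvi, hvj, h1 v hv]
  · have : e ≠ f := fun h => he (h ▸ hfU)
    simp [this, h2 e he]
  · rw [cutValue_update_of_nonpos hf hx hc]
    exact h3 S
  · have := sum_update_add m.2 f c
    simp only [Pi.add_apply, Finset.sum_add_distrib, Finset.sum_pi_single', Finset.mem_univ,
      if_true]
    linarith

lemma ncard_feasible_neg (hf : ends f = s(i, j)) (hfU : f ∈ U) (hi : i ∈ W) (hj : j ∈ W) :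
    {m ∈ feasible ends W U (n + 1) | m.2 f < 0}.ncard =
      {m ∈ feasible ends W U n | m.2 f ≤ 0}.ncard := by
  refine Set.ncard_congr (fun m _ => (m.1 + Pi.single i (m.2 f - (m.2 f + 1)) +
    Pi.single j (m.2 f - (m.2 f + 1)), Function.update m.2 f (m.2 f + 1))) ?_ ?_ ?_
  · rintro m ⟨hm, hx⟩
    have := update_mem_feasible_of_nonpos hf hfU hi hj hm hx.le (c := m.2 f + 1) hx
    refine ⟨by convert this using 2; ring, ?_⟩
    simpa using hx
  · rintro ⟨y, x⟩ ⟨y', x'⟩ - - h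
    simp only [Prod.mk.injEq, sub_add_cancel_left, add_left_inj] at h ⊢
    have hxf : x f = x' f := by simpa using congrFun h.2 f
    refine ⟨h.1, ?_⟩
    exact eq_of_update_eq hxf h.2
  · rintro m ⟨hm, hx⟩
    have := update_mem_feasible_of_nonpos hf hfU hi hj hm hx (c := m.2 f - 1) (by linarith)
    refine ⟨_, ⟨by convert this using 2; ring, by simpa using Int.lt_add_one_of_le hx⟩, ?_⟩
    have h1 : (Pi.single i (1 : ℤ) : V → ℤ) + Pi.single i (-1) = 0 := by
      rw [← Pi.single_add]; simp
    have h2 : (Pi.single j (1 : ℤ) : V → ℤ) + Pi.single j (-1) = 0 := by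
      rw [← Pi.single_add]; simp
    ext v
    · have h1 := congrFun h1 v
      have h2 := congrFun h2 v
      simp at h1 h2 ⊢
      linarith
    · simp

/-- If no cut separating the ends of `f` is tight, then the coordinate of `f` can be decreased. -/
lemma update_mem_feasible_of_not_tight (hf : ends f = s(i, j)) (hfU : f ∈ U)
    (hm : m ∈ feasible ends W U n) (hx : 1 ≤ m.2 f)
    (ht : ∀ S : Finset V, ¬(i ∈ S ↔ j ∈ S) → cutValue ends S m.1 m.2 ≠ 0) :
    (m.1, Function.update m.2 f (m.2 f - 1)) ∈ feasible ends W U (n - 1) := by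
  obtain ⟨h1, h2, h3, h4⟩ := hm
  refine ⟨h1, fun e he => ?_, fun S => ?_, ?_⟩
  · have : e ≠ f := fun h => he (h ▸ hfU)
    simp [this, h2 e he]
  · by_cases hS : i ∈ S ↔ j ∈ S
    · rw [cutValue_update_of_not_separated hf (by linarith) (by linarith) hS]
      exact h3 S
    · rw [cutValue_update_of_separated hf _ hS]
      have := ht S hS
      have := h3 S
      dsimp only
      omega
  · have := sum_update_add m.2 f (m.2 f - 1)
    linarith

lemma two_mul_le_cutValue_of_tight (hf : ends f = s(i, j)) (hm : m ∈ feasible ends W U n)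
    (hx : 0 ≤ m.2 f) {S T : Finset V} (hiS : i ∈ S) (hjS : j ∉ S)
    (hS : cutValue ends S m.1 m.2 = 0) (hjT : j ∈ T) (hiT : i ∉ T) :
    2 * m.2 f ≤ cutValue ends T m.1 m.2 := by
  have := cutValue_inter_add_union_add (y := m.1) hf hx hiS hjS hjT hiT
  have := hm.2.2.1 (S ∩ T)
  have := hm.2.2.1 (S ∪ T)
  linarith

lemma disjoint_tightSet (hf : ends f = s(i, j)) :
    Disjoint (tightSet ends W U n f i j) (tightSet ends W U n f j i) := by
  rw [Set.disjoint_left]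
  rintro m ⟨hm, hx, S, hiS, hjS, hS⟩ ⟨-, -, T, hjT, hiT, hT⟩
  have := two_mul_le_cutValue_of_tight hf hm (by linarith) hiS hjS hS hjT hiT
  linarith

lemma ncard_feasible_pos (hf : ends f = s(i, j)) (hfU : f ∈ U) :
    {m ∈ feasible ends W U (n + 1) | 1 ≤ m.2 f}.ncard =
      {m ∈ feasible ends W U n | 0 ≤ m.2 f}.ncard +
        (tightSet ends W U (n + 1) f i j).ncard + (tightSet ends W U (n + 1) f j i).ncard := by
  have hfin := finite_feasible (ends := ends) (W := W) (U := U) (n := n + 1)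
  have hfin' : ∀ i j, (tightSet ends W U (n + 1) f i j).Finite := fun i j =>
    hfin.subset fun m hm => hm.1
  have hsub : tightSet ends W U (n + 1) f i j ∪ tightSet ends W U (n + 1) f j i ⊆
      {m ∈ feasible ends W U (n + 1) | 1 ≤ m.2 f} := by
    rintro m (hm | hm) <;> exact ⟨hm.1, hm.2.1⟩
  rw [← Set.ncard_sdiff_add_ncard_of_subset hsub (hfin.subset fun m hm => hm.1),
    Set.ncard_union_eq (disjoint_tightSet hf) (hfin' _ _) (hfin' _ _), ← add_assoc]
  congr 2
  refine Set.ncard_congr (fun m _ => (m.1, Function.update m.2 f (m.2 f - 1))) ?_ ?_ ?_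
  · rintro m ⟨⟨hm, hx⟩, ht⟩
    have := update_mem_feasible_of_not_tight hf hfU hm hx fun S hS h0 => ht <| by
      by_cases hi : i ∈ S
      · exact Or.inl ⟨hm, hx, S, hi, by tauto, h0⟩
      · exact Or.inr ⟨hm, hx, S, by tauto, hi, h0⟩
    refine ⟨by convert this using 2; ring, ?_⟩
    simpa using hx
  · rintro ⟨y, x⟩ ⟨y', x'⟩ - - h
    simp only [Prod.mk.injEq] at h ⊢
    have hxf : x f = x' f := by simpa using congrFun h.2 f
    refine ⟨h.1, ?_⟩
    exact eq_of_update_eq hxf h.2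
  · rintro m ⟨hm, hx⟩
    have hcut : ∀ S : Finset V, ¬(i ∈ S ↔ j ∈ S) →
        1 ≤ cutValue ends S m.1 (Function.update m.2 f (m.2 f + 1)) := fun S hS => by
      rw [cutValue_update_of_separated hf _ hS]
      have := hm.2.2.1 S
      linarith
    refine ⟨(m.1, Function.update m.2 f (m.2 f + 1)),
      ⟨⟨⟨hm.1, fun e he => ?_, fun S => ?_, ?_⟩, ?_⟩, ?_⟩, ?_⟩
    · have : e ≠ f := fun h => he (h ▸ hfU)
      simp [this, hm.2.1 e he]
    · by_cases hS : i ∈ S ↔ j ∈ S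
      · rw [cutValue_update_of_not_separated hf hx (by linarith) hS]
        exact hm.2.2.1 S
      · linarith [hcut S hS]
    · have := sum_update_add m.2 f (m.2 f + 1)
      have := hm.2.2.2
      linarith
    · simpa using hx
    · rintro (⟨-, -, S, h1, h2, h3⟩ | ⟨-, -, S, h1, h2, h3⟩)
      · have := hcut S (by tauto); dsimp only at h3; linarith
      · have := hcut S (by tauto); dsimp only at h3; linarith
    · simp

/-- Moving the coordinate of `f` one step towards `0` matches the feasible points of degree `n + 1`
with those of degree `n`, except for the points with coordinate `-1` or `0` at `f`, which correspond
to feasible points for the multigraph without `f`, and for the tight points. -/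
lemma ncard_feasible_insert (hf : ends f = s(i, j)) (hfU : f ∉ U) (hi : i ∈ W) (hj : j ∈ W) :
    (feasible ends W (insert f U) (n + 1)).ncard =
      (feasible ends W (insert f U) n).ncard + (feasible ends W U n).ncard +
        (feasible ends W U (n + 1)).ncard +
        (tightSet ends W (insert f U) (n + 1) f i j).ncard +
        (tightSet ends W (insert f U) (n + 1) f j i).ncard := by
  have hfin : ∀ n, (feasible ends W (insert f U) n).Finite := fun n => finite_feasible
  have hfU' := Finset.mem_insert_self f U
  have hneg := ncard_feasible_neg (n := n) hf hfU' hi hj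
  have hpos := ncard_feasible_pos (W := W) (n := n) hf hfU'
  have split : ∀ (s t u : Set ((V → ℤ) × (E → ℤ))), s.Finite → Disjoint t u → s = t ∪ u →
      s.ncard = t.ncard + u.ncard := by
    rintro s t u hs h rfl
    exact Set.ncard_union_eq h (hs.subset Set.subset_union_left) (hs.subset Set.subset_union_right)
  have h1 := split (feasible ends W (insert f U) (n + 1))
    {m ∈ feasible ends W (insert f U) (n + 1) | m.2 f < 0}
    {m ∈ feasible ends W (insert f U) (n + 1) | 0 ≤ m.2 f} (hfin _)
    (Set.disjoint_left.2 fun m h h' => absurd h.2 (not_lt.2 h'.2))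
    (by ext m; simp only [Set.mem_union, Set.mem_ofPred_eq, ← and_or_left]
        have := lt_or_ge (m.2 f) 0; tauto)
  have h2 := split {m ∈ feasible ends W (insert f U) (n + 1) | 0 ≤ m.2 f}
    {m ∈ feasible ends W (insert f U) (n + 1) | 1 ≤ m.2 f}
    {m ∈ feasible ends W (insert f U) (n + 1) | m.2 f = 0} ((hfin _).subset fun m h => h.1)
    (Set.disjoint_left.2 fun m h h' => by have := h.2; have := h'.2; omega)
    (by ext m; simp only [Set.mem_union, Set.mem_ofPred_eq, ← and_or_left]
        have : 0 ≤ m.2 f ↔ (1 ≤ m.2 f ∨ m.2 f = 0) := by omega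
        tauto)
  have h3 := split (feasible ends W (insert f U) n)
    {m ∈ feasible ends W (insert f U) n | m.2 f < 0}
    {m ∈ feasible ends W (insert f U) n | 0 ≤ m.2 f} (hfin _)
    (Set.disjoint_left.2 fun m h h' => absurd h.2 (not_lt.2 h'.2))
    (by ext m; simp only [Set.mem_union, Set.mem_ofPred_eq, ← and_or_left]
        have := lt_or_ge (m.2 f) 0; tauto)
  have h4 := split {m ∈ feasible ends W (insert f U) n | m.2 f ≤ 0}
    {m ∈ feasible ends W (insert f U) n | m.2 f < 0}
    {m ∈ feasible ends W (insert f U) n | m.2 f = 0} ((hfin _).subset fun m h => h.1)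
    (Set.disjoint_left.2 fun m h h' => by have := h.2; have := h'.2; omega)
    (by ext m; simp only [Set.mem_union, Set.mem_ofPred_eq, ← and_or_left]
        have : m.2 f ≤ 0 ↔ (m.2 f < 0 ∨ m.2 f = 0) := by omega
        tauto)
  rw [feasible_insert_inter_eq_zero hfU] at h2 h4
  omega

/-- Tight points are enumerated by contraction: merge the vertex `i` into `j`, and use the vertex
`i`, which becomes isolated, to remember the coordinate of `f`. The coordinate of `i` can be
recovered, as it is the least one for which all cuts separating `i` from `j` are nonnegative. -/
lemma ncard_tightSet (hf : ends f = s(i, j)) (hij : i ≠ j) (hfU : f ∉ U) (hi : i ∈ W) (hj : j ∈ W) :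
    (tightSet ends W (insert f U) (n + 1) f i j).ncard =
      (feasible (fun e => (ends e).map (Function.update id i j)) W U n).ncard := by
  have hpre : ∀ S : Finset V, ∀ v, v ∈ (Finset.univ.filter fun v => Function.update id i j v ∈ S) ↔
      if v = i then j ∈ S else v ∈ S := fun S v => by
    simp [Function.update_apply, apply_ite (· ∈ S)]
  have hpsum : ∀ (S : Finset V) (y : V → ℤ),
      ∑ v ∈ Finset.univ.filter (fun v => Function.update id i j v ∈ S), y v =
        ∑ v ∈ S, y v + (if j ∈ S then y i else 0) - if i ∈ S then y i else 0 := fun S y => by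
    have h1 : ∑ v ∈ Finset.univ.filter (fun v => Function.update id i j v ∈ S), y v =
        ∑ v, if v = i then (if j ∈ S then y i else 0) else if v ∈ S then y v else 0 := by
      rw [Finset.sum_filter]
      refine Finset.sum_congr rfl fun v _ => ?_
      by_cases hv : v = i
      · subst hv; simp
      · simp [hv]
    have h2 : ∑ v ∈ S, y v = ∑ v, if v ∈ S then y v else 0 := by simp
    rw [h1, h2, ← Finset.add_sum_erase _ _ (Finset.mem_univ i),
      ← Finset.add_sum_erase (Finset.univ) (fun v => if v ∈ S then y v else 0) (Finset.mem_univ i)]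
    have h3 : ∑ v ∈ Finset.univ.erase i, (if v = i then (if j ∈ S then y i else 0) else
        if v ∈ S then y v else 0) = ∑ v ∈ Finset.univ.erase i, if v ∈ S then y v else 0 :=
      Finset.sum_congr rfl fun v hv => by rw [if_neg (Finset.ne_of_mem_erase hv)]
    rw [h3]
    simp only [if_true]
    ring
  -- the cut functions of the contraction in terms of those of the original multigraph
  have hcut : ∀ (S : Finset V) (y : V → ℤ) (x : E → ℤ),
      cutValue (fun e => (ends e).map (Function.update id i j)) S y x =
        cutValue ends (Finset.univ.filter fun v => Function.update id i j v ∈ S) y x -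
          (if j ∈ S then y i else 0) + if i ∈ S then y i else 0 := fun S y x => by
    simp only [cutValue, cutWeight_map]
    rw [hpsum]
    ring
  have hsep : ∀ S : Finset V, (i ∈ Finset.univ.filter (fun v => Function.update id i j v ∈ S)) ↔
      (j ∈ Finset.univ.filter (fun v => Function.update id i j v ∈ S)) := fun S => by
    rw [hpre, hpre, if_pos rfl, if_neg hij.symm]
  refine Set.ncard_congr (fun m _ => (m.1 + Pi.single j (m.1 i) + Pi.single i (m.2 f - 1 - m.1 i),
    Function.update m.2 f 0)) ?_ ?_ ?_
  · rintro ⟨y, x⟩ ⟨⟨h1, h2, h3, h4⟩, hx, -⟩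
    dsimp only at *
    refine ⟨fun v hv => ?_, fun e he => ?_, fun S => ?_, ?_⟩
    · have hvi : v ≠ i := fun h => hv (h ▸ hi)
      have hvj : v ≠ j := fun h => hv (h ▸ hj)
      simp [hvi, hvj, h1 v hv]
    · by_cases hef : e = f
      · simp [hef]
      · simp [hef, h2 e (by simp [hef, he])]
    · dsimp only
      rw [hcut, cutValue_update_of_not_separated hf (by linarith) le_rfl (hsep S),
        cutValue_add_single, cutValue_add_single]
      have h0 := h3 (Finset.univ.filter fun v => Function.update id i j v ∈ S)
      simp only [hpre, if_true, if_neg hij.symm, Pi.add_apply, Pi.single_eq_same,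
        Pi.single_eq_of_ne hij]
      by_cases hiS : i ∈ S <;> by_cases hjS : j ∈ S <;> simp only [hiS, hjS, if_true, if_false] <;>
        linarith
    · have := sum_update_add x f 0
      simp only [Pi.add_apply, Finset.sum_add_distrib, Finset.sum_pi_single', Finset.mem_univ,
        if_true]
      linarith
  · rintro ⟨y, x⟩ ⟨y', x'⟩ ⟨⟨h1, h2, h3, h4⟩, hx, S, hiS, hjS, hS⟩
      ⟨⟨h1', h2', h3', h4'⟩, hx', S', hiS', hjS', hS'⟩ h
    simp only [Prod.mk.injEq] at h ⊢
    dsimp only at *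
    have hxf : x f = x' f := by
      have := congrFun h.1 i
      simp [hij] at this
      exact this
    have hxx : x = x' := by
      exact eq_of_update_eq hxf h.2
    subst hxx
    have hy : y' = y + Pi.single i (y' i - y i) + Pi.single j (y i - y' i) := by
      ext v
      have := congrFun h.1 v
      by_cases hvi : v = i
      · subst hvi; simp [hij]
      · by_cases hvj : v = j
        · subst hvj; simp [hvi] at this ⊢; linarith
        · simp [hvi, hvj] at this ⊢; exact this.symm
    have key : ∀ S, i ∈ S → j ∉ S → cutValue ends S y' x = cutValue ends S y x + (y' i - y i) := by
      intro S hi hj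
      conv_lhs => rw [hy]
      rw [cutValue_add_single, cutValue_add_single, if_pos hi, if_neg hj, add_zero]
    have e1 := key S hiS hjS
    have e2 := key S' hiS' hjS'
    have e3 := h3' S
    have e4 := h3 S'
    have : y' i - y i = 0 := by linarith
    refine ⟨?_, rfl⟩
    rw [hy, this, show y i - y' i = 0 by linarith]
    simp
  · rintro ⟨y, x⟩ ⟨h1, h2, h3, h4⟩
    dsimp only at *
    have hxf : x f = 0 := h2 f hfU
    have hyi : 0 ≤ y i := by
      have := h3 {i}
      rw [hcut] at this
      have he : (Finset.univ.filter fun v => Function.update id i j v ∈ ({i} : Finset V)) = ∅ := by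
        ext v
        rw [hpre]
        by_cases hv : v = i <;> simp [hv, hij.symm]
      rw [he] at this
      simpa [hij.symm, cutValue, cutWeight_empty] using this
    -- the cuts of the contraction are the cuts which do not separate `i` from `j`
    have hns : ∀ T : Finset V, (i ∈ T ↔ j ∈ T) →
        0 ≤ cutValue ends T (y - Pi.single i (y i)) x := fun T hT => by
      have hTp : (Finset.univ.filter fun v => Function.update id i j v ∈ T.erase i) = T := by
        ext v
        rw [hpre]
        by_cases hv : v = i
        · subst hv; simp [hij.symm, hT]
        · simp [hv]
      have := h3 (T.erase i)
      rw [hcut, hTp] at this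
      rw [sub_eq_add_neg, ← Pi.single_neg, cutValue_add_single]
      by_cases hj : j ∈ T <;> simp [hT, hj, hij.symm] at this ⊢ <;> linarith
    let z : V → ℤ := y - Pi.single i (y i)
    let x₁ : E → ℤ := Function.update x f (y i + 1)
    obtain ⟨S₀, hS₀, hmin⟩ := Finset.exists_min_image
      (Finset.univ.filter fun S : Finset V => i ∈ S ∧ j ∉ S) (fun S => cutValue ends S z x₁)
      ⟨{i}, by simp [hij.symm]⟩
    simp only [Finset.mem_filter, Finset.mem_univ, true_and] at hS₀ hmin
    set t := cutValue ends S₀ z x₁ with ht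
    have hx₁ : x₁ f = y i + 1 := by simp [x₁]
    have hns₁ : ∀ T : Finset V, (i ∈ T ↔ j ∈ T) → 0 ≤ cutValue ends T z x₁ := fun T hT => by
      rw [cutValue_update_of_not_separated hf (by linarith) (by linarith) hT]
      exact hns T hT
    have hv : ∀ T : Finset V, cutValue ends T (z + Pi.single i (-t) + Pi.single j t) x₁ =
        cutValue ends T z x₁ + (if i ∈ T then -t else 0) + if j ∈ T then t else 0 := fun T => by
      rw [cutValue_add_single, cutValue_add_single]
    refine ⟨(z + Pi.single i (-t) + Pi.single j t, x₁), ⟨⟨fun v hv => ?_, fun e he => ?_,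
      fun T => ?_, ?_⟩, ?_, S₀, hS₀.1, hS₀.2, ?_⟩, ?_⟩
    · have hvi : v ≠ i := fun h => hv (h ▸ hi)
      have hvj : v ≠ j := fun h => hv (h ▸ hj)
      simp [z, hvi, hvj, h1 v hv]
    · have hef : e ≠ f := fun h => he (by simp [h])
      simp [x₁, hef, h2 e fun h => he (Finset.mem_insert_of_mem h)]
    · dsimp only
      rw [hv]
      by_cases hiT : i ∈ T <;> by_cases hjT : j ∈ T <;> simp only [hiT, hjT, if_true, if_false]
      · have := hns₁ T (by tauto); linarith
      · have := hmin T ⟨hiT, hjT⟩; linarith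
      · have e1 := cutValue_inter_add_union_add (y := z) (x := x₁) hf (by linarith)
          hS₀.1 hS₀.2 hjT hiT
        have e2 := hns₁ (S₀ ∩ T) (by simp [hiT, hS₀.2])
        have e3 := hns₁ (S₀ ∪ T) (by simp [hjT, hS₀.1])
        linarith
      · have := hns₁ T (by tauto); linarith
    · have := sum_update_add x f (y i + 1)
      simp only [z, Pi.add_apply, Pi.sub_apply, Finset.sum_add_distrib, Finset.sum_sub_distrib,
        Finset.sum_pi_single', Finset.mem_univ, if_true]
      change _ + ∑ e, Function.update x f (y i + 1) e = _
      linarith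
    · change 1 ≤ x₁ f
      linarith
    · dsimp only
      rw [hv, if_pos hS₀.1, if_neg hS₀.2]
      linarith
    · ext v
      · by_cases hvi : v = i
        · subst hvi; simp [z, hij, hx₁]
        · by_cases hvj : v = j
          · subst hvj; simp [z, hvi, hij]
          · simp [z, hvi, hvj]
      · by_cases hef : v = f <;> simp [hef, x₁, hxf]

end Recursion

/-! ### The sum over forests -/

section ForestSum

variable {V E : Type*} [DecidableEq V]

/-- The vector `e_i + e_j` over `ZMod 2`, for an edge with ends `i` and `j`. A set of edges is (the
edge set of) a forest if and only if these vectors are linearly independent. -/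
def incVec : Sym2 V → V → ZMod 2 :=
  Sym2.lift ⟨fun i j => Pi.single i 1 + Pi.single j 1, fun _ _ => add_comm _ _⟩

lemma incVec_mk (i j : V) : incVec s(i, j) = Pi.single i 1 + Pi.single j 1 := rfl

lemma incVec_self (i : V) : incVec s(i, i) = 0 := ZModModule.add_self _

lemma incVec_ne_zero {i j : V} (h : i ≠ j) : incVec s(i, j) ≠ 0 := fun h0 => by
  simpa [incVec_mk, h] using congrFun h0 i

/-- The linear map which merges the vertex `i` into the vertex `j`. -/
def mergeMap (i j : V) : (V → ZMod 2) →ₗ[ZMod 2] (V → ZMod 2) where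
  toFun y := y + y i • incVec s(i, j)
  map_add' y z := by simp only [Pi.add_apply, add_smul]; abel
  map_smul' c y := by simp [smul_add, mul_smul]

lemma mergeMap_single (i j v : V) :
    mergeMap i j (Pi.single v 1) = Pi.single (Function.update id i j v) 1 := by
  change Pi.single v 1 + (Pi.single v 1 : V → ZMod 2) i • incVec s(i, j) = _
  by_cases hv : v = i
  · subst hv
    rw [Pi.single_eq_same, one_smul, incVec_mk, ← add_assoc, ZModModule.add_self, zero_add,
      Function.update_self]
  · rw [Pi.single_eq_of_ne (Ne.symm hv), zero_smul, add_zero, Function.update_of_ne hv, id]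

lemma mergeMap_incVec (i j : V) (e : Sym2 V) :
    mergeMap i j (incVec e) = incVec (e.map (Function.update id i j)) := by
  induction e with | h a b =>
  rw [incVec_mk, map_add, mergeMap_single, mergeMap_single, Sym2.map_mk, incVec_mk]

lemma ker_mergeMap {i j : V} (h : i ≠ j) :
    LinearMap.ker (mergeMap i j) = Submodule.span (ZMod 2) {incVec s(i, j)} := by
  ext y
  rw [LinearMap.mem_ker, Submodule.mem_span_singleton]
  change y + y i • incVec s(i, j) = 0 ↔ _
  constructor
  · intro hy
    exact ⟨y i, ((add_eq_zero_iff_eq_neg.1 hy).trans (ZModModule.neg_eq_self _)).symm⟩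
  · rintro ⟨c, rfl⟩
    rw [add_eq_zero_iff_eq_neg, ZModModule.neg_eq_self]
    simp [incVec_mk, h]

lemma linearIndepOn_insert_iff_contract {ends : E → Sym2 V} {f : E} {i j : V}
    (hf : ends f = s(i, j)) (hij : i ≠ j) {F : Set E} (hfF : f ∉ F) :
    LinearIndepOn (ZMod 2) (fun e => incVec (ends e)) (insert f F) ↔
      LinearIndepOn (ZMod 2) (fun e => incVec ((ends e).map (Function.update id i j))) F := by
  have hs : LinearIndepOn (ZMod 2) (fun e => incVec (ends e)) {f} := by
    rw [linearIndepOn_singleton_iff, hf]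
    exact incVec_ne_zero hij
  rw [← Set.singleton_union, linearIndepOn_union_iff_quotient (by simpa using hfF),
    and_iff_right hs, Set.image_singleton, hf, ← ker_mergeMap hij]
  have hinj := LinearMap.ker_eq_bot.1 (Submodule.ker_liftQ_eq_bot _ (mergeMap i j) le_rfl le_rfl)
  have : (fun e => incVec ((ends e).map (Function.update id i j))) =
      (LinearMap.ker (mergeMap i j)).liftQ (mergeMap i j) le_rfl ∘
        ((LinearMap.ker (mergeMap i j)).mkQ ∘ fun e => incVec (ends e)) := by
    ext1 e
    simp [← mergeMap_incVec]
  rw [this, LinearMap.linearIndepOn_iff_of_injOn _ hinj.injOn]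

open Classical in
/-- The sum `∑_F (2z)^|F| (1+z)^(|U|-|F|)` over all forests `F ⊆ U`. -/
noncomputable def forestSum {R : Type*} [CommRing R] (ends : E → Sym2 V) (U : Finset E) (z : R) :
    R :=
  ∑ F ∈ U.powerset.filter (fun F : Finset E => LinearIndepOn (ZMod 2) (fun e => incVec (ends e)) F),
    (2 * z) ^ F.card * (1 + z) ^ (U.card - F.card)

variable {R : Type*} [CommRing R] {ends : E → Sym2 V} {U : Finset E} {f : E} {i j : V} (z : R)

lemma forestSum_empty : forestSum ends ∅ z = 1 := by
  simp [forestSum, Finset.filter_singleton]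

lemma forestSum_insert_aux [DecidableEq E] (hfU : f ∉ U) :
    forestSum ends (insert f U) z = (1 + z) * forestSum ends U z +
      open Classical in ∑ F ∈ U.powerset,
        if LinearIndepOn (ZMod 2) (fun e => incVec (ends e)) (insert f (F : Set E)) then
          2 * z * ((2 * z) ^ F.card * (1 + z) ^ (U.card - F.card)) else 0 := by
  simp only [forestSum, Finset.sum_filter]
  rw [Finset.sum_powerset_insert hfU, Finset.mul_sum]
  congr 1
  · refine Finset.sum_congr rfl fun F hF => ?_
    have := Finset.card_le_card (Finset.mem_powerset.1 hF)
    rw [Finset.card_insert_of_notMem hfU, Nat.sub_add_comm this, pow_succ]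
    split_ifs <;> ring
  · refine Finset.sum_congr rfl fun F hF => ?_
    have hfF : f ∉ F := fun h => hfU (Finset.mem_powerset.1 hF h)
    rw [Finset.card_insert_of_notMem hfU, Finset.card_insert_of_notMem hfF, Finset.coe_insert,
      Nat.add_sub_add_right, pow_succ]
    split_ifs <;> ring

/-- Deletion and contraction of a non-loop. -/
lemma forestSum_insert [DecidableEq E] (hf : ends f = s(i, j)) (hij : i ≠ j) (hfU : f ∉ U) :
    forestSum ends (insert f U) z = (1 + z) * forestSum ends U z +
      2 * z * forestSum (fun e => (ends e).map (Function.update id i j)) U z := by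
  classical
  rw [forestSum_insert_aux z hfU, forestSum.eq_def (fun e => (ends e).map _), Finset.sum_filter,
    Finset.mul_sum]
  congr 1
  refine Finset.sum_congr rfl fun F hF => ?_
  have hfF : f ∉ F := fun h => hfU (Finset.mem_powerset.1 hF h)
  rw [mul_ite, mul_zero]
  refine if_congr (linearIndepOn_insert_iff_contract hf hij (by simpa using hfF)) rfl rfl

/-- Deletion of a loop. -/
lemma forestSum_insert_loop [DecidableEq E] (hf : ends f = s(i, i)) (hfU : f ∉ U) :
    forestSum ends (insert f U) z = (1 + z) * forestSum ends U z := by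
  rw [forestSum_insert_aux z hfU, Finset.sum_eq_zero, add_zero]
  intro F _
  rw [if_neg fun h => ?_]
  have := h.ne_zero (Set.mem_insert f _)
  exact this (by simp only [hf, incVec_self])

end ForestSum

/-! ### The Ehrhart series of the feasible points -/

section Series

variable {V E : Type*} [Fintype V] [Fintype E] {ends : E → Sym2 V} {W : Finset V} {U : Finset E}

/-- The generating function of the feasible points by degree. -/
noncomputable def feasibleSeries (ends : E → Sym2 V) (W : Finset V) (U : Finset E) :
    PowerSeries ℤ :=
  PowerSeries.mk fun n => ((feasible ends W U n).ncard : ℤ)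

lemma feasible_zero : feasible ends W U 0 = {0} := by
  classical
  ext m
  constructor
  · intro hm
    have hx : ∀ e, m.2 e = 0 := fun e => abs_nonpos_iff.1 (abs_le_of_mem_feasible hm e)
    have hy : ∀ v ∈ Finset.univ, 0 ≤ m.1 v := fun v _ => by
      simpa using neg_le_of_mem_feasible hm v
    have hs := hm.2.2.2
    simp only [hx, Finset.sum_const_zero, add_zero] at hs
    rw [Finset.sum_eq_zero_iff_of_nonneg hy] at hs
    exact Prod.ext (funext fun v => hs v (Finset.mem_univ v)) (funext hx)
  · rintro rfl
    refine ⟨by simp, by simp, fun S => ?_, by simp⟩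
    simp [cutValue, cutWeight_zero]

lemma ncard_feasible_empty [DecidableEq V] (n : ℕ) :
    (feasible ends W ∅ n).ncard = (W.finsuppAntidiag n).card := by
  rw [← Set.ncard_coe_finset]
  symm
  refine Set.ncard_congr (fun l _ => (fun v => (l v : ℤ), 0)) ?_ ?_ ?_
  · intro l hl
    rw [Finset.mem_coe, Finset.mem_finsuppAntidiag] at hl
    refine ⟨fun v hv => ?_, fun e _ => rfl, fun S => ?_, ?_⟩
    · simpa using Finsupp.notMem_support_iff.1 fun h => hv (hl.2 h)
    · simp only [cutValue, Pi.zero_apply, cutWeight_zero, Finset.sum_const_zero, add_zero]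
      exact Finset.sum_nonneg fun v _ => by positivity
    · simp only [Pi.zero_apply, Finset.sum_const_zero, add_zero]
      rw [← hl.1, Nat.cast_sum]
      symm
      refine Finset.sum_subset (Finset.subset_univ W) fun v _ hv => ?_
      simpa using Finsupp.notMem_support_iff.1 fun h => hv (hl.2 h)
  · intro l l' _ _ h
    ext v
    simpa using congrFun (Prod.ext_iff.1 h).1 v
  · rintro ⟨y, x⟩ ⟨h1, h2, h3, h4⟩
    obtain rfl : x = 0 := funext fun e => h2 e (Finset.notMem_empty e)
    have hy : ∀ v, 0 ≤ y v := fun v => by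
      simpa [cutValue, cutWeight_zero] using h3 {v}
    refine ⟨Finsupp.equivFunOnFinite.symm fun v => (y v).toNat, ?_, ?_⟩
    · rw [Finset.mem_coe, Finset.mem_finsuppAntidiag]
      constructor
      · zify
        simp only [Finsupp.equivFunOnFinite_symm_apply_apply, Int.toNat_of_nonneg (hy _)]
        simp only [Pi.zero_apply, Finset.sum_const_zero, add_zero] at h4
        rw [← h4]
        exact Finset.sum_subset (Finset.subset_univ W) fun v _ hv => h1 v hv
      · intro v hv
        by_contra hvW
        have := h1 v hvW
        dsimp only at this
        simp [this] at hv
    · simp [Int.toNat_of_nonneg (hy _)]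

lemma feasibleSeries_empty : feasibleSeries ends W ∅ * (1 - PowerSeries.X) ^ W.card = 1 := by
  classical
  have : feasibleSeries ends W ∅ = (PowerSeries.mk 1 : PowerSeries ℤ) ^ W.card := by
    ext n
    rw [← Finset.prod_const, PowerSeries.coeff_prod, feasibleSeries, PowerSeries.coeff_mk,
      ncard_feasible_empty]
    simp
  rw [this, ← mul_pow, PowerSeries.mk_one_mul_one_sub_eq_one, one_pow]

lemma feasibleSeries_insert [DecidableEq V] [DecidableEq E] {f : E} {i j : V}
    (hf : ends f = s(i, j)) (hij : i ≠ j) (hfU : f ∉ U) (hi : i ∈ W) (hj : j ∈ W) :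
    feasibleSeries ends W (insert f U) * (1 - PowerSeries.X) =
      (1 + PowerSeries.X) * feasibleSeries ends W U +
        PowerSeries.X * feasibleSeries (fun e => (ends e).map (Function.update id i j)) W U +
        PowerSeries.X * feasibleSeries (fun e => (ends e).map (Function.update id j i)) W U := by
  ext n
  rw [mul_sub, mul_one, mul_comm _ PowerSeries.X, add_mul, one_mul]
  cases n with
  | zero => simp [feasibleSeries, feasible_zero]
  | succ n =>
    simp only [map_add, map_sub, PowerSeries.coeff_succ_X_mul, feasibleSeries,
      PowerSeries.coeff_mk]
    have h := ncard_feasible_insert (W := W) (n := n) hf hfU hi hj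
    rw [ncard_tightSet hf hij hfU hi hj, ncard_tightSet (hf.trans Sym2.eq_swap) hij.symm hfU hj hi]
      at h
    push_cast
    rw [h]
    push_cast
    ring

lemma feasibleSeries_insert_loop [DecidableEq V] [DecidableEq E] {f : E} {i : V}
    (hf : ends f = s(i, i)) (hfU : f ∉ U) (hi : i ∈ W) :
    feasibleSeries ends W (insert f U) * (1 - PowerSeries.X) =
      (1 + PowerSeries.X) * feasibleSeries ends W U := by
  ext n
  rw [mul_sub, mul_one, mul_comm _ PowerSeries.X, add_mul, one_mul]
  cases n with
  | zero => simp [feasibleSeries, feasible_zero]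
  | succ n =>
    simp only [map_add, map_sub, PowerSeries.coeff_succ_X_mul, feasibleSeries,
      PowerSeries.coeff_mk]
    have h := ncard_feasible_insert (W := W) (n := n) hf hfU hi hi
    rw [tightSet_self, Set.ncard_empty] at h
    push_cast
    rw [h]
    push_cast
    ring

/-- The generating function of the feasible points has the sum over forests as numerator, since both
obey the same deletion-contraction rule. -/
theorem feasibleSeries_mul_one_sub_pow [DecidableEq V] (hW : ∀ e ∈ U, ∀ v ∈ ends e, v ∈ W) :
    feasibleSeries ends W U * (1 - PowerSeries.X) ^ (W.card + U.card) =
      forestSum ends U PowerSeries.X := by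
  classical
  induction U using Finset.induction_on generalizing ends with
  | empty => rw [Finset.card_empty, add_zero, feasibleSeries_empty, forestSum_empty]
  | insert f U hfU ih =>
    have hU := ih fun e he => hW e (Finset.mem_insert_of_mem he)
    obtain ⟨i, j, hf⟩ : ∃ i j, ends f = s(i, j) := by
      induction h : ends f with | h i j => exact ⟨i, j, rfl⟩
    have hi : i ∈ W := hW f (Finset.mem_insert_self f U) i (by simp [hf])
    have hj : j ∈ W := hW f (Finset.mem_insert_self f U) j (by simp [hf])
    have hcontr : ∀ i j, j ∈ W →
        feasibleSeries (fun e => (ends e).map (Function.update id i j)) W U *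
        (1 - PowerSeries.X) ^ (W.card + U.card) =
          forestSum (fun e => (ends e).map (Function.update id i j)) U PowerSeries.X :=
      fun i j hj => ih fun e he v hv => by
        obtain ⟨w, hw, rfl⟩ := Sym2.mem_map.1 hv
        by_cases hwi : w = i
        · simpa [hwi] using hj
        · simpa [hwi] using hW e (Finset.mem_insert_of_mem he) w hw
    rw [Finset.card_insert_of_notMem hfU, ← add_assoc, pow_succ', ← mul_assoc]
    by_cases hij : i = j
    · subst hij
      rw [feasibleSeries_insert_loop hf hfU hi, mul_assoc, hU, forestSum_insert_loop _ hf hfU]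
    · have h1 := forestSum_insert (PowerSeries.X : PowerSeries ℤ) hf hij hfU
      have h2 := forestSum_insert (PowerSeries.X : PowerSeries ℤ) (hf.trans Sym2.eq_swap)
        (Ne.symm hij) hfU
      rw [feasibleSeries_insert hf hij hfU hi hj, add_mul, add_mul, mul_assoc, mul_assoc, mul_assoc,
        hU, hcontr i j hj, hcontr j i hi]
      -- contracting `f` in either direction yields the same sum
      have h3 : (PowerSeries.X : PowerSeries ℤ) *
          (2 * forestSum (fun e => (ends e).map (Function.update id i j)) U PowerSeries.X) =
          PowerSeries.X *
          (2 * forestSum (fun e => (ends e).map (Function.update id j i)) U PowerSeries.X) := by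
        linear_combination h2 - h1
      have h4 := mul_left_cancel₀ PowerSeries.X_ne_zero h3
      rw [two_mul, two_mul] at h4
      have h5 : forestSum (fun e => (ends e).map (Function.update id i j)) U
          (PowerSeries.X : PowerSeries ℤ) =
          forestSum (fun e => (ends e).map (Function.update id j i)) U PowerSeries.X := by
        ext n
        have := congrArg (PowerSeries.coeff n) h4
        rw [map_add, map_add] at this
        omega
      rw [h1, ← h5]
      ring

end Series

/-! ### Lattice points and dimension of the polytope -/

section Polytope

variable {V E : Type*}

/-- The vertices `e_i + e_j - e_f`, `e_i - e_j + e_f` and `-e_i + e_j + e_f` of the cosmological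
polytope of the multigraph with edge ends given by `ends`. -/
def generators [DecidableEq V] [DecidableEq E] (ends : E → Sym2 V) : Set (V ⊕ E → ℝ) :=
  {p | ∃ (i j : V) (f : E), ends f = s(i, j) ∧
    (p = Pi.single (.inl i) 1 + Pi.single (.inl j) 1 - Pi.single (.inr f) 1 ∨
     p = Pi.single (.inl i) 1 - Pi.single (.inl j) 1 + Pi.single (.inr f) 1 ∨
     p = -Pi.single (.inl i) 1 + Pi.single (.inl j) 1 + Pi.single (.inr f) 1)}

variable {ends : E → Sym2 V}

lemma cutWeight_concave (S : Finset V) (e : Sym2 V) {a b : ℝ} (ha : 0 ≤ a) (hb : 0 ≤ b)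
    (x y : ℝ) : a * cutWeight S e x + b * cutWeight S e y ≤ cutWeight S e (a * x + b * y) := by
  unfold cutWeight
  split_ifs
  · refine le_min ?_ ?_
    · nlinarith [min_le_left 0 (2 * x), min_le_left 0 (2 * y)]
    · nlinarith [min_le_right 0 (2 * x), min_le_right 0 (2 * y)]
  · exact le_rfl
  · simp

lemma cutValue_concave [Fintype E] (S : Finset V) {a b : ℝ} (ha : 0 ≤ a) (hb : 0 ≤ b)
    (p q : V ⊕ E → ℝ) :
    a * cutValue ends S (p ∘ Sum.inl) (p ∘ Sum.inr) +
      b * cutValue ends S (q ∘ Sum.inl) (q ∘ Sum.inr) ≤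
      cutValue ends S ((a • p + b • q) ∘ Sum.inl) ((a • p + b • q) ∘ Sum.inr) := by
  have h := Finset.sum_le_sum fun e (_ : e ∈ Finset.univ) =>
    cutWeight_concave S (ends e) ha hb (p (.inr e)) (q (.inr e))
  simp only [cutValue, Function.comp_apply, Pi.add_apply, Pi.smul_apply, smul_eq_mul,
    Finset.sum_add_distrib, mul_add, ← Finset.mul_sum] at h ⊢
  linarith

open Classical in
/-- The vertices which are incident to some edge. -/
noncomputable def support [Fintype V] (ends : E → Sym2 V) : Finset V :=
  Finset.univ.filter fun v => ∃ e, v ∈ ends e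

lemma mem_support [Fintype V] {v : V} : v ∈ support ends ↔ ∃ e, v ∈ ends e := by simp [support]

variable [DecidableEq V] [DecidableEq E]

lemma add_sub_mem_convexHull {i j : V} {f : E} (hf : ends f = s(i, j)) :
    (Pi.single (.inl i) 1 + Pi.single (.inl j) 1 - Pi.single (.inr f) 1 : V ⊕ E → ℝ) ∈
      convexHull ℝ (generators ends) :=
  subset_convexHull _ _ ⟨i, j, f, hf, Or.inl rfl⟩

lemma sub_add_mem_convexHull {i j : V} {f : E} (hf : ends f = s(i, j)) :
    (Pi.single (.inl i) 1 - Pi.single (.inl j) 1 + Pi.single (.inr f) 1 : V ⊕ E → ℝ) ∈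
      convexHull ℝ (generators ends) :=
  subset_convexHull _ _ ⟨i, j, f, hf, Or.inr (Or.inl rfl)⟩

lemma single_inl_mem_convexHull {v : V} {f : E} (hv : v ∈ ends f) :
    (Pi.single (.inl v) 1 : V ⊕ E → ℝ) ∈ convexHull ℝ (generators ends) := by
  obtain ⟨w, hf⟩ := hv
  convert (convex_convexHull ℝ (generators ends)) (add_sub_mem_convexHull hf)
    (sub_add_mem_convexHull hf) (a := 1 / 2) (b := 1 / 2) (by norm_num) (by norm_num)
    (by norm_num) using 1
  module

lemma single_inr_mem_convexHull (f : E) :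
    (Pi.single (.inr f) 1 : V ⊕ E → ℝ) ∈ convexHull ℝ (generators ends) := by
  obtain ⟨i, j, hf⟩ : ∃ i j, ends f = s(i, j) := by
    induction h : ends f with | h i j => exact ⟨i, j, rfl⟩
  convert (convex_convexHull ℝ (generators ends)) (sub_add_mem_convexHull hf)
    (sub_add_mem_convexHull (hf.trans Sym2.eq_swap)) (a := 1 / 2) (b := 1 / 2) (by norm_num)
    (by norm_num) (by norm_num) using 1
  module

lemma cutValue_generator_nonneg [Fintype E] {i j : V} {f : E} (hf : ends f = s(i, j))
    (S : Finset V) {a b c : ℝ}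
    (h : a = 1 ∧ b = 1 ∧ c = -1 ∨ a = 1 ∧ b = -1 ∧ c = 1 ∨ a = -1 ∧ b = 1 ∧ c = 1) :
    0 ≤ cutValue ends S (0 + Pi.single i a + Pi.single j b) (Function.update 0 f c) := by
  have h0 : cutValue ends S (0 : V → ℝ) (0 : E → ℝ) = 0 := by simp [cutValue, cutWeight_zero]
  rw [cutValue_add_single, cutValue_add_single, cutValue_update, h0, hf, cutWeight_mk,
    cutWeight_mk]
  obtain ⟨rfl, rfl, rfl⟩ | ⟨rfl, rfl, rfl⟩ | ⟨rfl, rfl, rfl⟩ := h <;>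
  by_cases hi : i ∈ S <;> by_cases hj : j ∈ S <;> simp [hi, hj] <;> norm_num

variable [Fintype V] [Fintype E]

/-- The points of the polytope satisfy the inequalities given by the cut functions. -/
lemma cutValue_nonneg_of_mem_convexHull {p : V ⊕ E → ℝ} (hp : p ∈ convexHull ℝ (generators ends)) :
    (∀ v ∉ support ends, p (.inl v) = 0) ∧
      (∀ S, 0 ≤ cutValue ends S (p ∘ Sum.inl) (p ∘ Sum.inr)) ∧ ∑ a, p a = 1 := by
  suffices h : convexHull ℝ (generators ends) ⊆ {p : V ⊕ E → ℝ |
      (∀ v ∉ support ends, p (.inl v) = 0) ∧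
      (∀ S, 0 ≤ cutValue ends S (p ∘ Sum.inl) (p ∘ Sum.inr)) ∧ ∑ a, p a = 1} from h hp
  refine convexHull_min ?_ ?_
  · have key : ∀ (i j : V) (f : E) (a b c : ℝ), ends f = s(i, j) →
        (a = 1 ∧ b = 1 ∧ c = -1 ∨ a = 1 ∧ b = -1 ∧ c = 1 ∨ a = -1 ∧ b = 1 ∧ c = 1) →
        (Pi.single (.inl i) a + Pi.single (.inl j) b + Pi.single (.inr f) c : V ⊕ E → ℝ) ∈
        {p : V ⊕ E → ℝ | (∀ v ∉ support ends, p (.inl v) = 0) ∧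
          (∀ S, 0 ≤ cutValue ends S (p ∘ Sum.inl) (p ∘ Sum.inr)) ∧ ∑ a, p a = 1} := by
      intro i j f a b c hf h
      refine ⟨fun v hv => ?_, fun S => ?_, ?_⟩
      · have hi : v ≠ i := fun h => hv (mem_support.2 ⟨f, by simp [hf, h]⟩)
        have hj : v ≠ j := fun h => hv (mem_support.2 ⟨f, by simp [hf, h]⟩)
        simp [hi, hj]
      · convert cutValue_generator_nonneg hf S h using 1
        congr 1
        · ext v; simp [Pi.single_apply]
        · ext e; simp [Pi.single_apply, Function.update_apply]
      · simp only [Pi.add_apply, Finset.sum_add_distrib, Finset.sum_pi_single', Finset.mem_univ,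
          if_true]
        obtain ⟨rfl, rfl, rfl⟩ | ⟨rfl, rfl, rfl⟩ | ⟨rfl, rfl, rfl⟩ := h <;> norm_num
    rintro p ⟨i, j, f, hf, rfl | rfl | rfl⟩
    · convert key i j f 1 1 (-1) hf (by simp) using 1
      rw [Pi.single_neg]; abel
    · convert key i j f 1 (-1) 1 hf (by simp) using 1
      rw [Pi.single_neg]; abel
    · convert key i j f (-1) 1 1 hf (by simp) using 1
      rw [Pi.single_neg]
  · rintro p ⟨hp1, hp2, hp3⟩ q ⟨hq1, hq2, hq3⟩ a b ha hb hab
    refine ⟨fun v hv => by simp [hp1 v hv, hq1 v hv], fun S => ?_, ?_⟩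
    · exact le_trans (add_nonneg (mul_nonneg ha (hp2 S)) (mul_nonneg hb (hq2 S)))
        (cutValue_concave S ha hb p q)
    · simp only [Pi.add_apply, Pi.smul_apply, smul_eq_mul, Finset.sum_add_distrib,
        ← Finset.mul_sum, hp3, hq3, mul_one, hab]

/-- Every feasible point of positive degree is the sum of a feasible point of smaller degree and a
lattice point of the polytope. -/
lemma exists_feasible_add {n : ℕ} {m : (V → ℤ) × (E → ℤ)}
    (hm : m ∈ feasible ends (support ends) Finset.univ ((n + 1 : ℕ) : ℤ)) :
    ∃ m' ∈ feasible ends (support ends) Finset.univ (n : ℤ),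
      ∃ p ∈ convexHull ℝ (generators ends),
        (Sum.elim (fun v => (m.1 v : ℝ)) (fun e => (m.2 e : ℝ)) : V ⊕ E → ℝ) =
          Sum.elim (fun v => (m'.1 v : ℝ)) (fun e => (m'.2 e : ℝ)) + p := by
  by_cases hx : ∃ f, m.2 f ≠ 0
  · obtain ⟨f, hx⟩ := hx
    obtain ⟨i, j, hf⟩ : ∃ i j, ends f = s(i, j) := by
      induction h : ends f with | h i j => exact ⟨i, j, rfl⟩
    have hi : i ∈ support ends := mem_support.2 ⟨f, by simp [hf]⟩
    have hj : j ∈ support ends := mem_support.2 ⟨f, by simp [hf]⟩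
    rcases lt_or_gt_of_ne hx with hx | hx
    · have h := update_mem_feasible_of_nonpos hf (Finset.mem_univ f) hi hj hm hx.le
        (c := m.2 f + 1) hx
      refine ⟨_, by convert h using 2; push_cast; ring, _, add_sub_mem_convexHull hf, ?_⟩
      ext (v | e)
      · simp [Pi.single_apply]
        split_ifs <;> ring
      · by_cases hef : e = f <;> simp [hef]
    · -- a tight cut `S` with `i ∈ S` and `j ∉ S` forces a unit of flow from `j` to `i`
      have key : ∀ i j : V, ends f = s(i, j) → i ∈ support ends → j ∈ support ends →
          ∀ S : Finset V, i ∈ S → j ∉ S → cutValue ends S m.1 m.2 = 0 →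
          (m.1 + Pi.single i 1 + Pi.single j (-1), Function.update m.2 f (m.2 f - 1)) ∈
            feasible ends (support ends) Finset.univ (n : ℤ) := by
        intro i j hf hi hj S hiS hjS hS
        refine ⟨fun v hv => ?_, fun e he => absurd (Finset.mem_univ e) he, fun T => ?_, ?_⟩
        · have hvi : v ≠ i := fun h => hv (h ▸ hi)
          have hvj : v ≠ j := fun h => hv (h ▸ hj)
          simp [hvi, hvj, hm.1 v hv]
        · dsimp only
          rw [cutValue_add_single, cutValue_add_single]
          have h0 := hm.2.2.1 T
          by_cases hT : i ∈ T ↔ j ∈ T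
          · rw [cutValue_update_of_not_separated hf hx.le (by linarith) hT]
            by_cases hjT : j ∈ T <;> simp only [hT, hjT, if_true, if_false] <;> linarith
          · rw [cutValue_update_of_separated hf _ hT]
            by_cases hjT : j ∈ T
            · have hiT : i ∉ T := by tauto
              have := two_mul_le_cutValue_of_tight hf hm hx.le hiS hjS hS hjT hiT
              simp only [hiT, hjT, if_true, if_false]
              linarith
            · have hiT : i ∈ T := by tauto
              simp only [hiT, hjT, if_true, if_false]
              linarith
        · have h1 := sum_update_add m.2 f (m.2 f - 1)
          have h2 := hm.2.2.2
          simp only [Pi.add_apply, Finset.sum_add_distrib, Finset.sum_pi_single', Finset.mem_univ,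
            if_true]
          push_cast at h2
          linarith
      have hsub : ∀ i j : V, ends f = s(i, j) → i ∈ support ends → j ∈ support ends →
          ∀ S : Finset V, i ∈ S → j ∉ S → cutValue ends S m.1 m.2 = 0 →
          ∃ m' ∈ feasible ends (support ends) Finset.univ (n : ℤ),
            ∃ p ∈ convexHull ℝ (generators ends),
              (Sum.elim (fun v => (m.1 v : ℝ)) (fun e => (m.2 e : ℝ)) : V ⊕ E → ℝ) =
                Sum.elim (fun v => (m'.1 v : ℝ)) (fun e => (m'.2 e : ℝ)) + p := by
        intro i j hf hi hj S hiS hjS hS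
        refine ⟨_, key i j hf hi hj S hiS hjS hS, _,
          sub_add_mem_convexHull (hf.trans Sym2.eq_swap), ?_⟩
        ext (v | e)
        · simp [Pi.single_apply]
          split_ifs <;> ring
        · by_cases hef : e = f <;> simp [hef]
      by_cases ht : ∃ S : Finset V, ¬(i ∈ S ↔ j ∈ S) ∧ cutValue ends S m.1 m.2 = 0
      · obtain ⟨S, hS, hS0⟩ := ht
        by_cases hiS : i ∈ S
        · exact hsub i j hf hi hj S hiS (by tauto) hS0
        · exact hsub j i (hf.trans Sym2.eq_swap) hj hi S (by tauto) hiS hS0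
      · have h := update_mem_feasible_of_not_tight hf (Finset.mem_univ f) hm hx
          fun S hS h0 => ht ⟨S, hS, h0⟩
        refine ⟨_, by convert h using 2; push_cast; ring, _, single_inr_mem_convexHull f, ?_⟩
        ext (v | e)
        · simp
        · by_cases hef : e = f <;> simp [hef]
  · push Not at hx
    obtain ⟨h1, h2, h3, h4⟩ := hm
    have hy : ∀ v, 0 ≤ m.1 v := fun v => by
      simpa [cutValue, cutWeight_zero, hx] using h3 {v}
    obtain ⟨v, hv⟩ : ∃ v, m.1 v ≠ 0 := by
      by_contra! h
      simp [hx, h] at h4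
      omega
    have hvs : v ∈ support ends := by
      by_contra h
      exact hv (h1 v h)
    obtain ⟨f, hf⟩ := mem_support.1 hvs
    refine ⟨(m.1 + Pi.single v (-1), m.2), ⟨fun w hw => ?_, h2, fun S => ?_, ?_⟩, _,
      single_inl_mem_convexHull hf, ?_⟩
    · have : w ≠ v := fun h => hw (h ▸ hvs)
      simp [this, h1 w hw]
    · simp only [cutValue, hx, cutWeight_zero, Finset.sum_const_zero, add_zero]
      refine Finset.sum_nonneg fun w _ => ?_
      by_cases hwv : w = v
      · subst hwv
        have := hy w
        simp
        omega
      · simp [hwv, hy w]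
    · simp only [Pi.add_apply, Finset.sum_add_distrib, Finset.sum_pi_single', Finset.mem_univ,
        if_true]
      push_cast at h4
      linarith
    · ext (w | e)
      · simp [Pi.single_apply]
        split_ifs <;> ring
      · simp

lemma exists_eq_smul_of_mem_feasible {n : ℕ} (hn : n ≠ 0) {m : (V → ℤ) × (E → ℤ)}
    (hm : m ∈ feasible ends (support ends) Finset.univ (n : ℤ)) :
    ∃ p ∈ convexHull ℝ (generators ends),
      (Sum.elim (fun v => (m.1 v : ℝ)) (fun e => (m.2 e : ℝ)) : V ⊕ E → ℝ) = (n : ℝ) • p := by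
  induction n generalizing m with
  | zero => exact absurd rfl hn
  | succ n ih =>
    obtain ⟨m', hm', p, hp, h⟩ := exists_feasible_add hm
    rcases Nat.eq_zero_or_pos n with rfl | hn0
    · rw [Nat.cast_zero, feasible_zero] at hm'
      obtain rfl := hm'
      refine ⟨p, hp, ?_⟩
      rw [h]
      ext (v | e) <;> simp
    · obtain ⟨q, hq, h'⟩ := ih hn0.ne' hm'
      have hpos : (0 : ℝ) < (n : ℝ) + 1 := by positivity
      refine ⟨_, convex_convexHull ℝ _ hq hp (a := n / ((n : ℝ) + 1)) (b := 1 / ((n : ℝ) + 1))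
        (by positivity) (by positivity) (by field_simp), ?_⟩
      rw [h, h', smul_add, smul_smul, smul_smul]
      push_cast
      rw [mul_div_cancel₀ _ hpos.ne', mul_div_cancel₀ _ hpos.ne', one_smul]

/-- The lattice points of the `t`-th dilate of the polytope are the feasible points of degree `t`.
-/
lemma ncard_latticePoints {t : ℕ} (ht : t ≠ 0) :
    (latticePoints (convexHull ℝ (generators ends)) t).ncard =
      (feasible ends (support ends) Finset.univ (t : ℤ)).ncard := by
  refine Set.ncard_congr (fun m _ => (m ∘ Sum.inl, m ∘ Sum.inr)) ?_ ?_ ?_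
  · rintro m ⟨p, hp, h⟩
    obtain ⟨h1, h2, h3⟩ := cutValue_nonneg_of_mem_convexHull hp
    refine ⟨fun v hv => ?_, fun e he => absurd (Finset.mem_univ e) he, fun S => ?_, ?_⟩
    · have := h (.inl v)
      rw [h1 v hv, mul_zero] at this
      exact_mod_cast this
    · have h4 := cutValue_concave (ends := ends) S (Nat.cast_nonneg t) le_rfl p (0 : V ⊕ E → ℝ)
      rw [zero_mul, add_zero, smul_zero, add_zero] at h4
      have h5 := (mul_nonneg (Nat.cast_nonneg t) (h2 S)).trans h4
      have h6 : ((cutValue ends S (m ∘ Sum.inl) (m ∘ Sum.inr) : ℤ) : ℝ) =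
          cutValue ends S (((t : ℝ) • p) ∘ Sum.inl) (((t : ℝ) • p) ∘ Sum.inr) := by
        simp only [cutValue, cutWeight, Function.comp_apply, Pi.smul_apply, smul_eq_mul, ← h]
        push_cast
        rfl
      rw [← h6] at h5
      exact_mod_cast h5
    · have h7 : ((∑ a, m a : ℤ) : ℝ) = (t : ℝ) := by
        push_cast
        simp only [h, ← Finset.mul_sum, h3, mul_one]
      rw [Fintype.sum_sum_type] at h7
      exact_mod_cast h7
  · intro m m' _ _ h
    ext (v | e)
    · exact congrFun (Prod.ext_iff.1 h).1 v
    · exact congrFun (Prod.ext_iff.1 h).2 e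
  · intro m hm
    obtain ⟨p, hp, h⟩ := exists_eq_smul_of_mem_feasible ht hm
    refine ⟨Sum.elim m.1 m.2, ⟨p, hp, ?_⟩, rfl⟩
    rintro (v | e)
    · exact congrFun h (.inl v)
    · exact congrFun h (.inr e)

lemma ehrhartSeries_convexHull_generators :
    ehrhartSeries (convexHull ℝ (generators ends)) =
      feasibleSeries ends (support ends) Finset.univ := by
  ext t
  rw [ehrhartSeries, feasibleSeries, PowerSeries.coeff_mk, PowerSeries.coeff_mk]
  split_ifs with ht
  · simp [ht, feasible_zero]
  · rw [ncard_latticePoints ht]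

/-- The polytope spans the affine space spanned by the unit vectors of its incident vertices and its
edges. -/
lemma affineSpan_convexHull_generators :
    affineSpan ℝ (convexHull ℝ (generators ends)) = affineSpan ℝ (Set.range
      fun a : (support ends).disjSum (Finset.univ : Finset E) =>
        (Pi.single a.1 1 : V ⊕ E → ℝ)) := by
  apply le_antisymm
  · rw [affineSpan_convexHull, affineSpan_le]
    have hv : ∀ {v f}, v ∈ ends f → (Pi.single (.inl v) 1 : V ⊕ E → ℝ) ∈ affineSpan ℝ (Set.range
        fun a : (support ends).disjSum (Finset.univ : Finset E) =>
          (Pi.single a.1 1 : V ⊕ E → ℝ)) := fun {v f} h =>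
      subset_affineSpan _ _ ⟨⟨.inl v, Finset.inl_mem_disjSum.2 (mem_support.2 ⟨f, h⟩)⟩, rfl⟩
    have he : ∀ f, (Pi.single (.inr f) 1 : V ⊕ E → ℝ) ∈ affineSpan ℝ (Set.range
        fun a : (support ends).disjSum (Finset.univ : Finset E) =>
          (Pi.single a.1 1 : V ⊕ E → ℝ)) := fun f =>
      subset_affineSpan _ _ ⟨⟨.inr f, Finset.inr_mem_disjSum.2 (Finset.mem_univ f)⟩, rfl⟩
    rintro p ⟨i, j, f, hf, hp⟩
    have hi := hv (show i ∈ ends f by simp [hf])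
    have hj := hv (show j ∈ ends f by simp [hf])
    have h1 := AffineSubspace.smul_vsub_vadd_mem _ (1 : ℝ) hi (he f) hj
    have h2 := AffineSubspace.smul_vsub_vadd_mem _ (1 : ℝ) hi hj (he f)
    have h3 := AffineSubspace.smul_vsub_vadd_mem _ (1 : ℝ) hj hi (he f)
    simp only [one_smul, vsub_eq_sub, vadd_eq_add] at h1 h2 h3
    rw [SetLike.mem_coe]
    obtain rfl | rfl | rfl := hp
    · convert h1 using 1; abel
    · exact h2
    · convert h3 using 1; abel
  · rw [affineSpan_le]
    rintro _ ⟨⟨v | e, ha⟩, rfl⟩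
    · obtain ⟨f, hf⟩ := mem_support.1 (Finset.inl_mem_disjSum.1 ha)
      exact subset_affineSpan _ _ (single_inl_mem_convexHull hf)
    · exact subset_affineSpan _ _ (single_inr_mem_convexHull e)

lemma dimSucc_convexHull_generators :
    dimSucc (convexHull ℝ (generators ends)) = (support ends).card + Fintype.card E := by
  unfold dimSucc
  rcases isEmpty_or_nonempty E with hE | ⟨⟨f⟩⟩
  · have h1 : generators ends = ∅ := by
      ext p
      simp [generators]
    have h2 : support ends = ∅ := by
      ext v
      simp [mem_support]
    simp [h1, h2]
  · rw [if_pos ⟨_, single_inr_mem_convexHull f⟩, ← direction_affineSpan,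
      affineSpan_convexHull_generators, direction_affineSpan]
    have : Nonempty ((support ends).disjSum (Finset.univ : Finset E)) :=
      ⟨⟨.inr f, Finset.inr_mem_disjSum.2 (Finset.mem_univ f)⟩⟩
    have hli : LinearIndependent ℝ fun a : (support ends).disjSum (Finset.univ : Finset E) =>
        (Pi.single a.1 1 : V ⊕ E → ℝ) := by
      have := (Pi.basisFun ℝ (V ⊕ E)).linearIndependent.comp
        (Subtype.val : (support ends).disjSum (Finset.univ : Finset E) → V ⊕ E)
        Subtype.val_injective
      convert this using 2
      simp
    rw [hli.affineIndependent.finrank_vectorSpan_add_one, Fintype.card_coe, Finset.card_disjSum,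
      Finset.card_univ]

/-- The `h^*`-polynomial of a cosmological polytope is the sum over forests. -/
theorem isHStarPolynomial_forestSum :
    IsHStarPolynomial (convexHull ℝ (generators ends))
      (forestSum ends Finset.univ Polynomial.X) := by
  unfold IsHStarPolynomial
  rw [ehrhartSeries_convexHull_generators, dimSucc_convexHull_generators, ← Finset.card_univ,
    feasibleSeries_mul_one_sub_pow fun e _ v hv => mem_support.2 ⟨e, hv⟩,
    ← Polynomial.coeToPowerSeries.ringHom_apply]
  simp only [forestSum, map_sum, map_mul, map_pow, map_add, map_one, map_ofNat,
    Polynomial.coeToPowerSeries.ringHom_apply, Polynomial.coe_X]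

end Polytope

/-! ### The lower bound for the sum over forests -/

section LowerBound

variable {V E : Type*} [DecidableEq V] {ends : E → Sym2 V}

lemma incVec_eq_zero_iff {e : Sym2 V} : incVec e = 0 ↔ e.IsDiag := by
  induction e with | h i j =>
  rw [Sym2.mk_isDiag_iff]
  refine ⟨fun h => ?_, ?_⟩
  · by_contra hij
    exact incVec_ne_zero hij h
  · rintro rfl
    exact incVec_self i

lemma coeff_two_mul_pow_mul_one_add_pow_nonneg (a b i : ℕ) :
    0 ≤ ((2 * Polynomial.X) ^ a * (1 + Polynomial.X) ^ b : Polynomial ℤ).coeff i := by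
  have : ((2 * Polynomial.X) ^ a * (1 + Polynomial.X) ^ b : Polynomial ℤ) =
      ((2 * Polynomial.X) ^ a * (1 + Polynomial.X) ^ b : Polynomial ℕ).map (Nat.castRingHom ℤ) := by
    simp
  rw [this, Polynomial.coeff_map]
  exact Int.natCast_nonneg _

/-- The subsets of a spanning forest contribute `(1+3z)^r (1+z)^(|E|-r)` to the sum over all
forests, where `r` is the rank. They are all the forests if and only if the non-loops form a
forest. -/
theorem forestSum_lower_bound [Fintype E] {r : ℕ}
    (hr : Module.finrank (ZMod 2)
      (Submodule.span (ZMod 2) (Set.range fun e => incVec (ends e))) = r) :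
    r ≤ Fintype.card E ∧
    (∀ i, ((1 + 3 * Polynomial.X) ^ r * (1 + Polynomial.X) ^ (Fintype.card E - r) :
      Polynomial ℤ).coeff i ≤ (forestSum ends Finset.univ Polynomial.X : Polynomial ℤ).coeff i) ∧
    ((1 + 3 * Polynomial.X) ^ r * (1 + Polynomial.X) ^ (Fintype.card E - r) =
      (forestSum ends Finset.univ Polynomial.X : Polynomial ℤ) ↔
        LinearIndepOn (ZMod 2) (fun e => incVec (ends e)) {e | ¬ (ends e).IsDiag}) := by
  classical
  obtain ⟨T', -, -, hspan, hT'⟩ := exists_linearIndepOn_extension (K := ZMod 2)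
    (v := fun e => incVec (ends e)) (linearIndepOn_empty _ _) (Set.empty_subset Set.univ)
  obtain ⟨T, rfl⟩ : ∃ T : Finset E, (T : Set E) = T' := ⟨T'.toFinset, by simp⟩
  have hcard : T.card = r := by
    have hsp : Submodule.span (ZMod 2) (Set.range fun e => incVec (ends e)) =
        Submodule.span (ZMod 2) ((fun e => incVec (ends e)) '' T) := by
      refine le_antisymm ?_ (Submodule.span_mono (Set.image_subset_range _ _))
      rw [Submodule.span_le, ← Set.image_univ]
      exact hspan
    rw [← hr, hsp, Set.image_eq_range]
    exact ((finrank_span_eq_card hT').trans (by simp)).symm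
  have hTle : T.card ≤ Fintype.card E := Finset.card_le_univ T
  set I := (Finset.univ : Finset E).powerset.filter
    (fun F : Finset E => LinearIndepOn (ZMod 2) (fun e => incVec (ends e)) F) with hI
  have hTI : T.powerset ⊆ I := fun F hF => by
    simp only [hI, Finset.mem_filter, Finset.powerset_univ, Finset.mem_univ, true_and]
    exact hT'.mono (by exact_mod_cast Finset.mem_powerset.1 hF)
  have hsum : ((1 + 3 * Polynomial.X) ^ r * (1 + Polynomial.X) ^ (Fintype.card E - r) :
      Polynomial ℤ) = ∑ F ∈ T.powerset, (2 * Polynomial.X) ^ F.card *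
        (1 + Polynomial.X) ^ ((Finset.univ : Finset E).card - F.card) := by
    rw [← hcard, show (1 + 3 * Polynomial.X : Polynomial ℤ) =
      2 * Polynomial.X + (1 + Polynomial.X) by ring, ← Finset.sum_pow_mul_eq_add_pow,
      Finset.sum_mul]
    refine Finset.sum_congr rfl fun F hF => ?_
    have hFT := Finset.card_le_card (Finset.mem_powerset.1 hF)
    rw [mul_assoc, ← pow_add, Finset.card_univ]
    congr 2
    omega
  have hdiff : (forestSum ends Finset.univ Polynomial.X : Polynomial ℤ) =
      (1 + 3 * Polynomial.X) ^ r * (1 + Polynomial.X) ^ (Fintype.card E - r) +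
      ∑ F ∈ I \ T.powerset, (2 * Polynomial.X) ^ F.card *
        (1 + Polynomial.X) ^ ((Finset.univ : Finset E).card - F.card) := by
    rw [hsum, add_comm, Finset.sum_sdiff hTI, forestSum]
  refine ⟨hcard ▸ hTle, fun i => ?_, ?_⟩
  · rw [hdiff, Polynomial.coeff_add, Polynomial.finsetSum_coeff]
    exact le_add_of_nonneg_right
      (Finset.sum_nonneg fun F _ => coeff_two_mul_pow_mul_one_add_pow_nonneg _ _ _)
  · rw [hdiff, left_eq_add]
    constructor
    · intro h0
      -- all summands are positive at `z = 1`, so every forest is contained in `T`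
      have h1 := congrArg (Polynomial.eval 1) h0
      rw [Polynomial.eval_finsetSum, Polynomial.eval_zero, Finset.sum_eq_zero_iff_of_nonneg] at h1
      · refine hT'.mono fun e he => ?_
        by_contra heT
        have : ({e} : Finset E) ∈ I \ T.powerset := by
          simp only [hI, Finset.mem_sdiff, Finset.mem_filter, Finset.powerset_univ, Finset.mem_univ,
            true_and, Finset.coe_singleton, Finset.mem_powerset, Finset.singleton_subset_iff]
          refine ⟨?_, heT⟩
          rw [linearIndepOn_singleton_iff]
          exact fun h => he (incVec_eq_zero_iff.1 h)
        have := h1 _ this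
        norm_num at this
      · intro F _
        norm_num
    · intro hN
      refine Finset.sum_eq_zero fun F hF => absurd ?_ (Finset.mem_sdiff.1 hF).2
      rw [Finset.mem_powerset]
      intro e he
      have hFi := (Finset.mem_filter.1 (Finset.mem_sdiff.1 hF).1).2
      have hnz : ∀ {F : Set E}, LinearIndepOn (ZMod 2) (fun e => incVec (ends e)) F → ∀ e ∈ F,
          ¬ (ends e).IsDiag := fun h e he hd => h.ne_zero he (incVec_eq_zero_iff.2 hd)
      by_contra heT
      have hins : insert e (T : Set E) ⊆ {e | ¬ (ends e).IsDiag} :=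
        Set.insert_subset (hnz hFi e he) fun e' he' => hnz hT' e' he'
      exact (hN.mono hins).notMem_span_of_insert (by simpa using heT)
        (hspan (Set.mem_image_of_mem _ (Set.mem_univ e)))

end LowerBound

/-! ### Rank and independence in terms of components and cycles -/

section Graphic

variable {V E : Type*} [DecidableEq V] {ends : E → Sym2 V} {S : SimpleGraph V}

lemma incVec_mem_of_reachable {M : Submodule (ZMod 2) (V → ZMod 2)}
    (hM : ∀ u v, S.Adj u v → incVec s(u, v) ∈ M) {u v : V} (h : S.Reachable u v) :
    incVec s(u, v) ∈ M := by
  obtain ⟨w⟩ := h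
  induction w with
  | nil => rw [incVec_self]; exact M.zero_mem
  | @cons u v w h _ ih =>
    have : incVec s(u, w) = incVec s(u, v) + incVec s(v, w) := by
      have h0 := ZModModule.add_self (Pi.single v 1 : V → ZMod 2)
      rw [incVec_mk, incVec_mk, incVec_mk]
      linear_combination -h0
    rw [this]
    exact M.add_mem (hM _ _ h) ih

lemma incVec_dotProduct [Fintype V] (u v : V) (χ : V → ZMod 2) :
    incVec s(u, v) ⬝ᵥ χ = χ u + χ v := by
  rw [incVec_mk, add_dotProduct, single_dotProduct, single_dotProduct, one_mul, one_mul]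

/-- If `i` and `j` lie in different components of a graph, then the indicator function of the
component of `i` separates `e_i + e_j` from the span of the vectors of the edges. -/
lemma incVec_notMem_span [Fintype V] {i j : V} (h : ¬ S.Reachable i j) {F : Set E}
    (hF : ∀ e ∈ F, ∀ u v, ends e = s(u, v) → S.Reachable u v) :
    incVec s(i, j) ∉ Submodule.span (ZMod 2) ((fun e => incVec (ends e)) '' F) := by
  classical
  intro hmem
  let χ : V → ZMod 2 := fun v => if S.Reachable i v then 1 else 0
  have key : ∀ y ∈ Submodule.span (ZMod 2) ((fun e => incVec (ends e)) '' F), y ⬝ᵥ χ = 0 := by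
    intro y hy
    induction hy using Submodule.span_induction with
    | mem y hy =>
      obtain ⟨e, he, rfl⟩ := hy
      obtain ⟨u, v, huv⟩ : ∃ u v, ends e = s(u, v) := by
        induction h : ends e with | h i j => exact ⟨i, j, rfl⟩
      have hr := hF e he u v huv
      have : S.Reachable i u ↔ S.Reachable i v := ⟨fun h => h.trans hr, fun h => h.trans hr.symm⟩
      simp only [huv, incVec_dotProduct, χ, this]
      exact ZModModule.add_self _
    | zero => exact zero_dotProduct _
    | add y z _ _ hy hz => rw [add_dotProduct, hy, hz, add_zero]
    | smul c y _ hy => rw [smul_dotProduct, hy, smul_zero]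
  have := key _ hmem
  simp [incVec_dotProduct, χ, h] at this

/-- The rank of the incidence vectors is the number of vertices minus the number of components. -/
lemma finrank_span_incVec_add_card [Fintype V] [Fintype E]
    (hS : ∀ u v, S.Adj u v ↔ u ≠ v ∧ ∃ e, ends e = s(u, v)) :
    Module.finrank (ZMod 2) (Submodule.span (ZMod 2) (Set.range fun e => incVec (ends e))) +
      Nat.card S.ConnectedComponent = Fintype.card V := by
  classical
  have : Fintype S.ConnectedComponent := Fintype.ofFinite _
  let M : Matrix E V (ZMod 2) := fun e => incVec (ends e)
  let Φ := LinearMap.funLeft (ZMod 2) (ZMod 2) S.connectedComponentMk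
  have hΦ : LinearMap.ker M.mulVecLin = LinearMap.range Φ := by
    ext χ
    rw [LinearMap.mem_ker, Matrix.mulVecLin_apply, LinearMap.mem_range]
    constructor
    · intro h
      have hadj : ∀ u v, S.Adj u v → χ u = χ v := fun u v huv => by
        obtain ⟨-, e, he⟩ := (hS u v).1 huv
        have h1 : incVec (ends e) ⬝ᵥ χ = 0 := congrFun h e
        rw [he, incVec_dotProduct] at h1
        exact CharTwo.add_eq_zero.1 h1
      have hw : ∀ u v (p : S.Walk u v), χ u = χ v := fun u v p => by
        induction p with
        | nil => rfl
        | cons h _ ih => exact (hadj _ _ h).trans ih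
      exact ⟨SimpleGraph.ConnectedComponent.lift χ fun u v p _ => hw u v p, rfl⟩
    · rintro ⟨φ, rfl⟩
      ext e
      change incVec (ends e) ⬝ᵥ _ = 0
      obtain ⟨u, v, huv⟩ : ∃ u v, ends e = s(u, v) := by
        induction h : ends e with | h i j => exact ⟨i, j, rfl⟩
      have : S.connectedComponentMk u = S.connectedComponentMk v := by
        by_cases h : u = v
        · rw [h]
        · exact SimpleGraph.ConnectedComponent.sound ((hS u v).2 ⟨h, e, huv⟩).reachable
      rw [huv, incVec_dotProduct, LinearMap.funLeft_apply, LinearMap.funLeft_apply, this]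
      exact CharTwo.add_self_eq_zero _
  have h1 := LinearMap.finrank_range_add_finrank_ker M.mulVecLin
  have hinj : Function.Injective Φ :=
    LinearMap.funLeft_injective_of_surjective _ _ _ Quot.mk_surjective
  rw [hΦ, LinearMap.finrank_range_of_inj hinj, Module.finrank_pi, Module.finrank_pi] at h1
  rw [Nat.card_eq_fintype_card, ← h1]
  congr 1
  exact M.rank_eq_finrank_span_row.symm

/-- The incidence vectors of the non-loops are independent if and only if there are no parallel
non-loops and the underlying simple graph is acyclic. -/
lemma linearIndepOn_incVec_iff [Fintype V]
    (hS : ∀ u v, S.Adj u v ↔ u ≠ v ∧ ∃ e, ends e = s(u, v)) :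
    LinearIndepOn (ZMod 2) (fun e => incVec (ends e)) {e | ¬ (ends e).IsDiag} ↔
      (∀ e f, ¬ (ends e).IsDiag → ends e = ends f → e = f) ∧ S.IsAcyclic := by
  constructor
  · intro h
    refine ⟨fun e f he hef => h.injOn he (show ¬ (ends f).IsDiag from hef ▸ he)
      (by simp only [hef]), ?_⟩
    rw [SimpleGraph.isAcyclic_iff_forall_adj_isBridge]
    intro i j hij
    rw [SimpleGraph.isBridge_iff]
    intro hr
    obtain ⟨hne, e, he⟩ := (hS i j).1 hij
    have hmem : incVec s(i, j) ∈ Submodule.span (ZMod 2)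
        ((fun e => incVec (ends e)) '' ({e | ¬ (ends e).IsDiag} \ {e})) := by
      refine incVec_mem_of_reachable (fun u v huv => ?_) hr
      rw [SimpleGraph.deleteEdges_adj] at huv
      obtain ⟨hne', f, hf⟩ := (hS u v).1 huv.1
      refine Submodule.subset_span ⟨f, ⟨by simpa [hf] using hne', ?_⟩, by simp only [hf]⟩
      rintro rfl
      exact huv.2 (by rw [← hf, he]; rfl)
    exact h.notMem_span (show e ∈ {e | ¬ (ends e).IsDiag} by simpa [he] using hne) (by rwa [he])
  · rintro ⟨hpar, hac⟩
    rw [linearIndepOn_iff_notMem_span]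
    intro e he
    obtain ⟨i, j, hij⟩ : ∃ u v, ends e = s(u, v) := by
      induction h : ends e with | h i j => exact ⟨i, j, rfl⟩
    have hne : i ≠ j := by simpa [hij] using he
    have hb := SimpleGraph.isAcyclic_iff_forall_adj_isBridge.1 hac ((hS i j).2 ⟨hne, e, hij⟩)
    rw [SimpleGraph.isBridge_iff] at hb
    rw [hij]
    refine incVec_notMem_span hb fun f hf u v huv => SimpleGraph.Adj.reachable ?_
    rw [SimpleGraph.deleteEdges_adj]
    refine ⟨(hS u v).2 ⟨by simpa [huv] using hf.1, f, huv⟩, fun h => hf.2 ?_⟩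
    exact (hpar e f he (by rw [hij, huv]; exact (Set.mem_singleton_iff.1 h).symm)).symm

end Graphic

/-! ### Multigraphs -/

section Multigraph

variable {α β : Type*} {G H : Graph α β}

lemma exists_ends (G : Graph α β) :
    ∃ ends : E(G) → Sym2 V(G), ∀ (f : E(G)) (i j : V(G)), G.IsLink f i j ↔ ends f = s(i, j) := by
  have h : ∀ f : E(G), ∃ e : Sym2 V(G), ∀ i j : V(G), G.IsLink f i j ↔ e = s(i, j) := fun f => by
    obtain ⟨x, y, hxy⟩ := G.exists_isLink_of_mem_edgeSet f.2
    refine ⟨s(⟨x, hxy.left_mem⟩, ⟨y, hxy.right_mem⟩), fun i j => ?_⟩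
    rw [hxy.isLink_iff, Sym2.eq_iff]
    simp only [Subtype.ext_iff]
  choose ends h using h
  exact ⟨ends, h⟩

lemma cosmologicalPolytope_eq [DecidableEq V(G)] [DecidableEq E(G)] {ends : E(G) → Sym2 V(G)}
    (h : ∀ (f : E(G)) (i j : V(G)), G.IsLink f i j ↔ ends f = s(i, j)) :
    cosmologicalPolytope G = convexHull ℝ (generators ends) := by
  have hu : ∀ a, unitVec G a = Pi.single a 1 := fun a => by
    ext b
    simp [unitVec, Pi.single_apply]
  simp only [cosmologicalPolytope, generators, hu, h]

/-- A finite multigraph is a `1`-sum of loops and a forest if and only if it has no parallel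
non-loops and its underlying simple graph is acyclic. -/
lemma isOneSumOfLoopsAndForest_iff (hE : E(G).Finite) :
    IsOneSumOfLoopsAndForest G ↔
      (∀ e f x y, x ≠ y → G.IsLink e x y → G.IsLink f x y → e = f) ∧ G.toSimpleGraph.IsAcyclic := by
  constructor
  · intro h
    clear hE
    induction h with
    | forest hF =>
      have := hF.1
      exact ⟨fun e f x y _ he hf => he.eq hf, hF.2⟩
    | @addLoop G H x l hH hG ih =>
      have hx : x ∈ V(H) := by
        have : x ∈ V(H) ∩ V(Graph.bouquet x {l}) := by rw [hG.vertexSet_inter]; rfl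
        exact this.1
      have hV : V(G) = V(H) := by
        rw [← hG.vertexSet_union, Graph.vertexSet_bouquet]
        exact Set.union_eq_left.2 (by simpa using hx)
      -- the only additional edge is a loop
      have hlink : ∀ e u v, u ≠ v → G.IsLink e u v → H.IsLink e u v := by
        intro e u v huv he
        have hmem := he.edge_mem
        rw [← hG.edgeSet_union] at hmem
        rcases hmem with hmem | hmem
        · exact (hG.left_le.isLink_iff hmem).2 he
        · have := (hG.right_le.isLink_iff hmem).2 he
          rw [Graph.bouquet_isLink] at this
          exact absurd (this.2.1.trans this.2.2.symm) huv
      refine ⟨fun e f u v huv he hf => ih.1 e f u v huv (hlink e u v huv he) (hlink f u v huv hf),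
        ?_⟩
      refine ih.2.comap (G := G.toSimpleGraph) (G' := H.toSimpleGraph)
        ⟨fun v => ⟨v.1, hV ▸ v.2⟩, fun {u v} huv => ?_⟩ fun u v huv => ?_
      · obtain ⟨hne, e, he⟩ := huv
        have hne' : u.1 ≠ v.1 := fun h => hne (Subtype.ext h)
        exact ⟨fun h => hne' (Subtype.mk.inj h), e, hlink e _ _ hne' he⟩
      · exact Subtype.ext (Subtype.mk.inj huv)
  · rintro ⟨h1, h2⟩
    induction hn : E(G).ncard generalizing G with
    | zero =>
      have hempty := (Set.ncard_eq_zero hE).1 hn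
      have hno : ∀ e x y, ¬ G.IsLink e x y := fun e x y h => by
        have := h.edge_mem
        simp [hempty] at this
      exact .forest ⟨{ not_isLoopAt := fun e x h => hno e x x h
                       eq_of_isLink := fun e f x y he _ => absurd he (hno e x y) }, h2⟩
    | succ n ih =>
      by_cases hl : ∃ l x, G.IsLoopAt l x
      · obtain ⟨l, x, hl⟩ := hl
        have hVd : V(G.deleteEdges {l}) = V(G) := rfl
        have hEd : E(G.deleteEdges {l}) = E(G) \ {l} := rfl
        have hLd : ∀ e u v, (G.deleteEdges {l}).IsLink e u v → G.IsLink e u v :=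
          fun e u v h => h.mono Graph.deleteEdges_le
        refine .addLoop (H := G.deleteEdges {l}) (x := x) (e := l) (ih ?_ ?_ ?_ ?_) ?_
        · exact hE.subset (hEd ▸ Set.sdiff_subset)
        · exact fun e f u v huv he hf => h1 e f u v huv (hLd _ _ _ he) (hLd _ _ _ hf)
        · refine h2.anti (G := (G.deleteEdges {l}).toSimpleGraph) fun u v huv => ?_
          obtain ⟨hne, e, he⟩ := huv
          exact ⟨hne, e, hLd _ _ _ he⟩
        · rw [hEd, Set.ncard_sdiff_singleton_of_mem hl.edge_mem, hn]
          rfl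
        · have hbl : ∀ e u v, (Graph.bouquet x {l}).IsLink e u v → G.IsLink e u v := by
            intro e u v h
            rw [Graph.bouquet_isLink] at h
            obtain ⟨rfl, rfl, rfl⟩ := h
            exact hl
          exact
            { left_le := Graph.deleteEdges_le
              right_le := ⟨by simpa using hl.vertex_mem, fun e u v h => hbl e u v h⟩
              vertexSet_union := by
                rw [hVd, Graph.vertexSet_bouquet]
                exact Set.union_eq_left.2 (by simpa using hl.vertex_mem)
              edgeSet_union := by
                rw [hEd]
                exact Set.sdiff_union_of_subset (by simpa using hl.edge_mem)
              vertexSet_inter := by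
                rw [hVd, Graph.vertexSet_bouquet]
                exact Set.inter_eq_right.2 (by simpa using hl.vertex_mem)
              edgeSet_disjoint := by
                rw [hEd]
                exact Set.disjoint_sdiff_left }
      · push Not at hl
        refine .forest ⟨{ not_isLoopAt := hl, eq_of_isLink := fun e f x y he hf => ?_ }, h2⟩
        refine h1 e f x y ?_ he hf
        rintro rfl
        exact hl e x he

end Multigraph

end Cosmo

theorem mainTheorem1 {α β : Type*} (G : Graph α β) (hV : V(G).Finite) (hE : E(G).Finite) :
    ∃ h : Polynomial ℤ, Cosmo.IsHStarPolynomial (Cosmo.cosmologicalPolytope G) h ∧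
      (∀ i : ℕ,
        ((1 + 3 * Polynomial.X) ^ (V(G).ncard - Cosmo.numComponents G) *
          (1 + Polynomial.X) ^ (E(G).ncard + Cosmo.numComponents G - V(G).ncard) :
            Polynomial ℤ).coeff i ≤ h.coeff i) ∧
      (((1 + 3 * Polynomial.X) ^ (V(G).ncard - Cosmo.numComponents G) *
          (1 + Polynomial.X) ^ (E(G).ncard + Cosmo.numComponents G - V(G).ncard) :
            Polynomial ℤ) = h ↔
        Cosmo.IsOneSumOfLoopsAndForest G) := by
  classical
  have : Fintype V(G) := hV.fintype
  have : Fintype E(G) := hE.fintype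
  obtain ⟨ends, hends⟩ := Cosmo.exists_ends G
  have hS : ∀ u v : V(G), G.toSimpleGraph.Adj u v ↔ u ≠ v ∧ ∃ e, ends e = s(u, v) := fun u v => by
    refine and_congr_right fun _ => ⟨fun ⟨e, he⟩ => ?_, fun ⟨e, he⟩ => ⟨e, (hends e u v).2 he⟩⟩
    exact ⟨⟨e, he.edge_mem⟩, (hends ⟨e, he.edge_mem⟩ u v).1 he⟩
  have hrank := Cosmo.finrank_span_incVec_add_card hS
  obtain ⟨hle, hcoeff, heq⟩ := Cosmo.forestSum_lower_bound (ends := ends) rfl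
  have hVc : V(G).ncard = Fintype.card V(G) := by
    rw [← Nat.card_coe_set_eq, Nat.card_eq_fintype_card]
  have hEc : E(G).ncard = Fintype.card E(G) := by
    rw [← Nat.card_coe_set_eq, Nat.card_eq_fintype_card]
  have e1 : V(G).ncard - Cosmo.numComponents G = Module.finrank (ZMod 2)
      (Submodule.span (ZMod 2) (Set.range fun e => Cosmo.incVec (ends e))) := by
    rw [Cosmo.numComponents, hVc]
    omega
  have e2 : E(G).ncard + Cosmo.numComponents G - V(G).ncard =
      Fintype.card E(G) - Module.finrank (ZMod 2)
        (Submodule.span (ZMod 2) (Set.range fun e => Cosmo.incVec (ends e))) := by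
    rw [Cosmo.numComponents, hVc, hEc]
    omega
  rw [e1, e2]
  refine ⟨Cosmo.forestSum ends Finset.univ Polynomial.X, ?_, hcoeff, heq.trans ?_⟩
  · rw [Cosmo.cosmologicalPolytope_eq hends]
    exact Cosmo.isHStarPolynomial_forestSum
  · rw [Cosmo.linearIndepOn_incVec_iff hS, Cosmo.isOneSumOfLoopsAndForest_iff hE]
    refine and_congr_left fun _ => ⟨fun h e f x y hxy he hf => ?_, fun h e f he hef => ?_⟩
    · have he' := (hends ⟨e, he.edge_mem⟩ ⟨x, he.left_mem⟩ ⟨y, he.right_mem⟩).1 he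
      have hf' := (hends ⟨f, hf.edge_mem⟩ ⟨x, he.left_mem⟩ ⟨y, he.right_mem⟩).1 hf
      exact congrArg Subtype.val (h _ _ (by simpa [he'] using hxy) (he'.trans hf'.symm))
    · obtain ⟨x, y, hxy⟩ : ∃ x y, ends e = s(x, y) := by
        induction h : ends e with | h i j => exact ⟨i, j, rfl⟩
      have hne : x.1 ≠ y.1 := fun h => he (by simp [hxy, Subtype.ext h])
      exact Subtype.ext (h e f x y hne ((hends e x y).2 hxy) ((hends f x y).2 (hef ▸ hxy)))
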